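/- Setting. Fix integers $0\le t<n$, agents $\mathit{Agt}=\{1,\dots,n\}$ and values $\{0,1\}$. A crash adversary with at most $t$ failures is a map $\mathcal F:\mathbb N\times \mathit{Agt}\times \mathit{Agt}\to\{\top,\bot\}$, where $\mathcal F(k,i,j)=\top$ means that in round $k+1$ (between times $k$ and $k+1$) the message from $i$ to $j$ is delivered, such that: $\mathcal F(k,i,j)=\bot$ implies $\mathcal F(k,i,i)=\bot$ (messages are lost only once the sender has crashed or is crashing in that round); $\mathcal F(k,i,i)=\bot$ implies $\mathcal F(k',i,j)=\bot$ for all $k'>k$ and all $j$; and at most $t$ agents $i$ have $\mathcal F(k,i,j)=\bot$ for some $k,j$. Agent $i$ enters the state $\mathit{crashed}$ for good at the end of the first round $k+1$ with $\mathcal F(k,i,i)=\bot$. The SendWaste exchange. The local state of an agent is $\mathit{crashed}$ or a tuple $\langle W,h,d,m,v\rangle$ with $W\subseteq\{0,1\}$, $h\in\mathbb N$, $d\in\mathbb Z$, time $m$ and initial value $v$. The initial states are $\langle\{v\},0,0,0,v\rangle$ with $v\in\{0,1\}$. In each round a noncrashed agent sends $(W,d)$ to every agent, itself included. An agent that does not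 crash in round $m+1$ moves from $\langle W,h,d,m,v\rangle$ to $\langle W',h',d',m+1,v\rangle$, where $W'$ is the union of the sets received, $h'$ is the number of agents from which no message was received in this round, and $d'$ is the maximum of $d$, all estimates received, and $h'-(m+1)$. A decision protocol $P$ assigns to each agent and local state one of the actions $\mathtt{decide}(0),\mathtt{decide}(1),\mathtt{noop}$; actions influence neither messages nor states. A run $r$ is given by an adversary and initial values, $r_i(m)$ is the local state of $i$ at time $m$, and $\mathcal I$ is the system of all runs. Let $\mathcal N(r,m)=\{i: r_i(m)\ne \mathit{crashed}\}$ and let $d_{\mathcal N}(r,m)$ be the maximum of the $d$-components of $r_i(m)$ over $i\in\mathcal N(r,m)$. Knowledge. $K_i\varphi$ holds at $(r,m)$ if $\varphi$ holds at all points $(r',m')$ of $\mathcal I$ with $r'_i(m')=r_i(m)$; $E_{\mathcal N}\varphi$ holds at $(r,m)$ if $K_i\varphi$ does for all $i\in\mathcal N(r,m)$; $C_{\mathcal N}\varphi$ holds if $E_{\mathcal N}^k\varphi$ does for all $k\ge1$. The proposition $\exists v$ says that some agent has initial value $v$. Protocols. $P$ decides $v$ for $i$ at $(r,m)$ if $P_i(r_i(m))=\mathtt{decide}(v)$.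 $P$ is an SBA protocol if in every run: any two decisions, at whatever times, made by agents that are nonfailed when they decide are for the same value; a value decided by a nonfailed agent is the initial value of some agent; and if some nonfailed agent decides at time $m$, then all agents of $\mathcal N(r,m)$ decide at time $m$. $P$ is an optimum SBA protocol if it is an SBA protocol and, for every SBA protocol $P'$ for the same exchange and $t$, whenever $i\in\mathcal N(r,m)$ decides some value at $(r,m)$ under $P'$, then $i$ decides some value under $P$ at time $m$ of the run with the same adversary and initial values. $P^{\mathrm{send}}$ is the protocol in which an agent in state $\langle W,h,d,m,v\rangle$ decides $\min W$ if $m\ge\min\{t+1,n-1\}-d$, and performs $\mathtt{noop}$ otherwise. Theorem. (1) For every run $r$ of SendWaste, every time $m$ and every agent $i$ that is nonfailed at $(r,m)$ (such an $i$ always exists), at least one of $C_{\mathcal N}(\exists 0)$, $C_{\mathcal N}(\exists 1)$ holds at $(r,m)$ if and only if $m\ge\min\{t+1,n-1\}-d_{\mathcal N}(r,m)$. (2) $P^{\mathrm{send}}$ is an optimum SBA protocol for the SendWaste exchange, and in every run every agent eventually decides or fails under $P^{\mathrm{send}}$. -/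

import Mathlib

namespace SBA

/-- The set `{0, 1}` of values. -/
abbrev Value : Type := Fin 2

/-- The actions available to an agent: decide a value, or do nothing. -/
inductive Action : Type where
  | decide (v : Value) : Action
  | noop : Action

/-- Failure patterns. `F k i j = true` says that in the round between time `k` and time `k + 1`
the message of agent `i` to agent `j` (if any) is delivered. Agent `i` crashes in that round,
or has crashed before, iff `F k i i = false`. -/
abbrev FailurePattern (n : ℕ) : Type := ℕ → Fin n → Fin n → Bool

/-- The crash failure model with at most `t` failures: messages are lost only from the round in
which the sender crashes, nothing is sent after a crash, and at most `t` agents crash. -/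
def Crash (n t : ℕ) : Set (FailurePattern n) :=
  {F | (∀ k i j, F k i j = false → F k i i = false) ∧
       (∀ k i, F k i i = false → ∀ k', k < k' → ∀ j, F k' i j = false) ∧
       {i : Fin n | ∃ k j, F k i j = false}.ncard ≤ t}

/-- An information exchange protocol for `n` agents under crash failures. `none` is the absent
message. -/
structure InfoExchange (n : ℕ) where
  /-- local states -/
  L : Type
  /-- messages -/
  M : Type
  /-- initial local states of each agent -/
  I : Fin n → Set L
  /-- the initial value recorded in an initial local state (irrelevant outside `I`) -/
  init : Fin n → L → Value
  /-- the time on the clock of an agent -/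
  time : Fin n → L → ℕ
  /-- the special state of an agent that has crashed -/
  crashed : L
  /-- message selection: `μ i s a j` is the message that `i` sends to `j` -/
  μ : Fin n → L → Action → Fin n → Option M
  /-- state update -/
  δ : Fin n → L → FailurePattern n → Action → (Fin n → Option M) → L
  init_bijOn : ∀ i, Set.BijOn (init i) (I i) Set.univ
  δ_crash : ∀ i s F a msgs, F (time i s) i i = false → δ i s F a msgs = crashed
  δ_crashed : ∀ i F a msgs, δ i crashed F a msgs = crashed

variable {n : ℕ}

/-- A decision protocol: a map from local states to actions for each agent. -/
abbrev DecisionProtocol (E : InfoExchange n) : Type := Fin n → E.L → Action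

/-- A global state: a state of the environment and a local state for each agent. -/
structure GlobalState (E : InfoExchange n) where
  env : FailurePattern n
  loc : Fin n → E.L

abbrev Run (E : InfoExchange n) : Type := ℕ → GlobalState E

/-- The runs generated by the decision protocol `P` and the information exchange `E` in the crash
failure model with at most `t` failures. -/
structure IsRun (E : InfoExchange n) (t : ℕ) (P : DecisionProtocol E) (r : Run E) : Prop where
  env_mem : (r 0).env ∈ Crash n t
  env_const : ∀ m, (r m).env = (r 0).env
  initial : ∀ i, (r 0).loc i ∈ E.I i
  step : ∀ k i, (r (k + 1)).loc i =
    E.δ i ((r k).loc i) (r k).env (P i ((r k).loc i))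
      (fun j => if (r k).env k j i = true
        then E.μ j ((r k).loc j) (P j ((r k).loc j)) i else none)

/-- The system generated by `P` and `E`. -/
def system (E : InfoExchange n) (t : ℕ) (P : DecisionProtocol E) : Set (Run E) :=
  {r | IsRun E t P r}

open Classical in
/-- The indexical set of nonfailed agents at the point `(r, m)`. -/
noncomputable def nonfailed (E : InfoExchange n) (r : Run E) (m : ℕ) : Finset (Fin n) :=
  Finset.univ.filter (fun i => (r m).loc i ≠ E.crashed)

/-- Propositions, as predicates of points. -/
abbrev PointProp (E : InfoExchange n) : Type := Run E → ℕ → Prop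

/-- `∃ v`: some agent has initial value `v`. -/
def existsInit (E : InfoExchange n) (v : Value) : PointProp E :=
  fun r _ => ∃ i, E.init i ((r 0).loc i) = v

/-- `K_i φ` in the system `R`. -/
def Knows {E : InfoExchange n} (R : Set (Run E)) (i : Fin n) (φ : PointProp E) : PointProp E :=
  fun r m => ∀ r' ∈ R, ∀ m', (r m).loc i = (r' m').loc i → φ r' m'

/-- `E_N φ` in the system `R`: every nonfailed agent knows `φ`. -/
def EveryoneKnows {E : InfoExchange n} (R : Set (Run E)) (φ : PointProp E) : PointProp E :=
  fun r m => ∀ i ∈ nonfailed E r m, Knows R i φ r m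

/-- `C_N φ` in the system `R`: common knowledge among the nonfailed agents. -/
def CommonKnowledge {E : InfoExchange n} (R : Set (Run E)) (φ : PointProp E) : PointProp E :=
  fun r m => ∀ k : ℕ, 1 ≤ k → ((EveryoneKnows R)^[k] φ) r m

/-- Corresponding runs: same failure pattern and same initial values. -/
def Corresponding {E : InfoExchange n} (r r' : Run E) : Prop :=
  (r 0).env = (r' 0).env ∧ ∀ i, E.init i ((r 0).loc i) = E.init i ((r' 0).loc i)

/-- The specification of simultaneous agreement: Agreement, Validity and Simultaneity. -/
structure IsSBA (E : InfoExchange n) (t : ℕ) (P : DecisionProtocol E) : Prop where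
  agreement : ∀ r ∈ system E t P, ∀ m m', ∀ i ∈ nonfailed E r m, ∀ j ∈ nonfailed E r m',
    ∀ v v', P i ((r m).loc i) = Action.decide v → P j ((r m').loc j) = Action.decide v' → v = v'
  validity : ∀ r ∈ system E t P, ∀ m, ∀ i ∈ nonfailed E r m,
    ∀ v, P i ((r m).loc i) = Action.decide v → existsInit E v r m
  simultaneity : ∀ r ∈ system E t P, ∀ m, ∀ i ∈ nonfailed E r m, ∀ j ∈ nonfailed E r m,
    (∃ v, P i ((r m).loc i) = Action.decide v) → ∃ w, P j ((r m).loc j) = Action.decide w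

/-- Termination: in every run every agent eventually decides or fails. -/
def Terminates (E : InfoExchange n) (t : ℕ) (P : DecisionProtocol E) : Prop :=
  ∀ r ∈ system E t P, ∀ i, ∃ m, i ∉ nonfailed E r m ∨ ∃ v, P i ((r m).loc i) = Action.decide v

/-- `P ≤ P'`: in corresponding runs, whenever a nonfailed agent decides under `P` it also decides
under `P'`. (A crashed agent no longer runs the protocol.) -/
def DecidesOnlyIf (E : InfoExchange n) (t : ℕ) (P P' : DecisionProtocol E) : Prop :=
  ∀ r ∈ system E t P, ∀ r' ∈ system E t P', Corresponding r r' →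
    ∀ m, ∀ i ∈ nonfailed E r m,
      (∃ v, P i ((r m).loc i) = Action.decide v) → ∃ w, P' i ((r' m).loc i) = Action.decide w

/-- `P` is an optimum SBA protocol with respect to `E`: every SBA protocol is below it. -/
def IsOptimumSBA (E : InfoExchange n) (t : ℕ) (P : DecisionProtocol E) : Prop :=
  IsSBA E t P ∧ ∀ P' : DecisionProtocol E, IsSBA E t P' → DecidesOnlyIf E t P' P

/-- Local states of SendWaste: `active W h d m v` has the set `W` of values seen, the number `h`
of messages missing in the last round, the waste estimate `d`, the time `m` and the initial
value `v`. -/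
inductive SendWasteState : Type where
  | crashed : SendWasteState
  | active (W : Finset Value) (h : ℕ) (d : ℤ) (m : ℕ) (v : Value) : SendWasteState

namespace SendWaste

/-- A message carries a set of values and a waste estimate. -/
abbrev Message : Type := Finset Value × ℤ

def initialStates : Set SendWasteState := {s | ∃ v, s = .active {v} 0 0 0 v}

def init : SendWasteState → Value
  | .crashed => 0
  | .active _ _ _ _ v => v

def time : SendWasteState → ℕ
  | .crashed => 0
  | .active _ _ _ m _ => m

/-- An agent sends `(W, d)` to every agent, itself included. -/
def send : SendWasteState → Option Message
  | .crashed => none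
  | .active W _ d _ _ => some (W, d)

/-- The union of the sets of values received. -/
def receivedValues (msgs : Fin n → Option Message) : Finset Value :=
  Finset.univ.biUnion (fun j => (msgs j).elim ∅ Prod.fst)

/-- The number of missing messages. -/
def missing (msgs : Fin n → Option Message) : ℕ :=
  (Finset.univ.filter (fun j => (msgs j).isNone)).card

/-- The maximum of the old estimate `d`, all estimates received, and `h - m`, where `h` is the
number of messages missing in the current round `m`. -/
def newEstimate (d : ℤ) (m : ℕ) (msgs : Fin n → Option Message) : ℤ :=
  Finset.univ.fold max (max d ((missing msgs : ℤ) - (m : ℤ)))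
    (fun j => (msgs j).elim d Prod.snd)

/-- The state update of agent `i`; the round that starts at time `m` is round `m + 1`. -/
def update (i : Fin n) (s : SendWasteState) (F : FailurePattern n)
    (msgs : Fin n → Option Message) : SendWasteState :=
  match s with
  | .crashed => .crashed
  | .active _ _ d m v =>
      if F m i i = false then .crashed
      else .active (receivedValues msgs) (missing msgs) (newEstimate d (m + 1) msgs) (m + 1) v

theorem init_bijOn : Set.BijOn init initialStates Set.univ := by
  refine ⟨fun _ _ => Set.mem_univ _, ?_, ?_⟩
  · rintro _ ⟨v, rfl⟩ _ ⟨w, rfl⟩ h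
    have h' : v = w := h
    rw [h']
  · intro v _
    exact ⟨.active {v} 0 0 0 v, ⟨v, rfl⟩, rfl⟩

theorem update_crash (i : Fin n) (s : SendWasteState) (F : FailurePattern n)
    (msgs : Fin n → Option Message) (h : F (time s) i i = false) :
    update i s F msgs = .crashed := by
  cases s with
  | crashed => rfl
  | active W k d m v => exact if_pos h

end SendWaste

/-- The SendWaste information exchange for `n` agents. -/
def sendWaste (n : ℕ) : InfoExchange n where
  L := SendWasteState
  M := SendWaste.Message
  I := fun _ => SendWaste.initialStates
  init := fun _ => SendWaste.init
  time := fun _ => SendWaste.time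
  crashed := .crashed
  μ := fun _ s _ _ => SendWaste.send s
  δ := fun i s F _ msgs => SendWaste.update i s F msgs
  init_bijOn := fun _ => SendWaste.init_bijOn
  δ_crash := fun i s F _ msgs h => SendWaste.update_crash i s F msgs h
  δ_crashed := fun _ _ _ _ => rfl

/-- The decision protocol `P^send`: decide `min W` as soon as `m ≥ min {t + 1, n - 1} - d`. -/
def pSend (n t : ℕ) : DecisionProtocol (sendWaste n) := fun _ s =>
  match (show SendWasteState from s) with
  | .crashed => Action.noop
  | .active W _ d m _ =>
      if (m : ℤ) ≥ min ((t : ℤ) + 1) ((n : ℤ) - 1) - d then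
        (if hW : W.Nonempty then Action.decide (W.min' hW) else Action.noop)
      else Action.noop

/-- The waste estimate in a local state (with default `0` in the crashed state). -/
def wasteEstimate : SendWasteState → ℤ
  | .crashed => 0
  | .active _ _ d _ _ => d

/-- `d_N (r, m)`: the maximal waste estimate of the nonfailed agents. -/
noncomputable def maxWaste (r : Run (sendWaste n)) (m : ℕ)
    (h : (nonfailed (sendWaste n) r m).Nonempty) : ℤ :=
  (nonfailed (sendWaste n) r m).sup' h (fun i => wasteEstimate ((r m).loc i))

end SBA

/-!
A waste estimate originates at a time `k` by which as many agents have crashed as the estimate plus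
`k`. If it allows a decision, then after time `k` there are too few crashes left for one in every
round: some round is clean, and equalizes the values seen, or only one agent survives.

Conversely, if the estimates are too low, then the run is joined to every run without crashes by a
chain of runs in which consecutive ones are indistinguishable to some nonfailed agent, so no value
is commonly known to exist. The crashes are undone one at a time, the latest first. As long as one
more crash per remaining round is possible, a message to `j` can be added after silencing `j`: to
silence `j` from some time on, crash it in the next round and undo, recursively, the loss of its
last messages. When one crash too many is in the way, the agent that misses the most messages has
received a message of one of the agents crashing in the last round with crashes, and it does not
notice if that crash is postponed by a round, from where it can be undone.
-/

namespace SBA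

open scoped Finset

variable {n t : ℕ}

/-! ### Common knowledge -/

section CommonKnowledge

variable {E : InfoExchange n} {R : Set (Run E)} {φ : PointProp E} {r r' : Run E} {m m' : ℕ}
  {i : Fin n}

theorem mem_nonfailed : i ∈ nonfailed E r m ↔ (r m).loc i ≠ E.crashed := by
  simp [nonfailed]

theorem mem_nonfailed_congr (h : (r m).loc i = (r' m').loc i) :
    i ∈ nonfailed E r m ↔ i ∈ nonfailed E r' m' := by
  rw [mem_nonfailed, mem_nonfailed, h]

theorem commonKnowledge_of_invariant (Q : PointProp E) (hφ : ∀ r ∈ R, ∀ m, Q r m → φ r m)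
    (hQ : ∀ r ∈ R, ∀ m, Q r m → EveryoneKnows R Q r m) (hr : r ∈ R) (h : Q r m) :
    CommonKnowledge R φ r m := by
  have iterate : ∀ k, ∀ r ∈ R, ∀ m, Q r m → ((EveryoneKnows R)^[k] φ) r m := by
    intro k
    induction k with
    | zero => exact hφ
    | succ k ih =>
      intro r hr m h
      rw [Function.iterate_succ_apply']
      exact fun i hi r' hr' m' hl => ih r' hr' m' (hQ r hr m h i hi r' hr' m' hl)
  exact fun k _ => iterate k r hr m h

theorem CommonKnowledge.of_loc_eq (h : CommonKnowledge R φ r m) (hi : i ∈ nonfailed E r m)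
    (hr' : r' ∈ R) (hl : (r m).loc i = (r' m').loc i) : CommonKnowledge R φ r' m' := by
  intro k _
  have hk := h (k + 1) (Nat.le_add_left 1 k)
  rw [Function.iterate_succ_apply'] at hk
  exact hk i hi r' hr' m' hl

theorem CommonKnowledge.holds (h : CommonKnowledge R φ r m) (hr : r ∈ R)
    (hi : i ∈ nonfailed E r m) : φ r m :=
  h 1 le_rfl i hi r hr m rfl

theorem IsSBA.commonKnowledge {P : DecisionProtocol E} (hP : IsSBA E t P) (hr : r ∈ system E t P)
    (hi : i ∈ nonfailed E r m) {v : Value} (hv : P i ((r m).loc i) = Action.decide v) :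
    CommonKnowledge (system E t P) (existsInit E v) r m := by
  refine commonKnowledge_of_invariant
    (fun r m => ∃ i ∈ nonfailed E r m, P i ((r m).loc i) = Action.decide v) ?_ ?_ hr ⟨i, hi, hv⟩
  · rintro r hr m ⟨i, hi, hv⟩
    exact hP.validity r hr m i hi v hv
  · rintro r hr m ⟨i, hi, hv⟩ j hj r' - m' hl
    obtain ⟨w, hw⟩ := hP.simultaneity r hr m i hi j hj ⟨v, hv⟩
    obtain rfl := hP.agreement r hr m m i hi j hj v w hv hw
    exact ⟨j, (mem_nonfailed_congr hl).mp hj, hl ▸ hw⟩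

end CommonKnowledge

namespace SendWaste

variable {F F' : FailurePattern n} {v v' : Fin n → Value} {m : ℕ} {i j : Fin n}

/-! ### Crashed and nonfailed agents -/

/-- Agent `i` has not crashed by time `m` under the failure pattern `F`. -/
def Alive (F : FailurePattern n) (m : ℕ) (i : Fin n) : Prop := ∀ k < m, F k i i = true

theorem alive_zero : Alive F 0 i := fun k hk => absurd hk k.not_lt_zero

theorem alive_top : Alive (⊤ : FailurePattern n) m i := fun _ _ => rfl

theorem Alive.mono {m' : ℕ} (h : Alive F m i) (hm : m' ≤ m) : Alive F m' i :=
  fun k hk => h k (hk.trans_le hm)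

theorem alive_succ : Alive F (m + 1) i ↔ Alive F m i ∧ F m i i = true :=
  Nat.forall_lt_succ_right

theorem top_mem_crash : (⊤ : FailurePattern n) ∈ Crash n t :=
  ⟨fun _ _ _ h => h, fun _ _ h => absurd h.symm Bool.false_ne_true, by simp⟩

theorem crash_subset_crash {t' : ℕ} (h : t ≤ t') : Crash n t ⊆ Crash n t' :=
  fun _ hF => ⟨hF.1, hF.2.1, hF.2.2.trans h⟩

theorem Alive.delivered (hF : F ∈ Crash n t) (h : Alive F (m + 1) i) : F m i j = true := by
  by_contra hij
  simpa [hF.1 m i j (by simpa using hij)] using h m m.lt_succ_self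

theorem not_delivered_of_not_alive (hF : F ∈ Crash n t) (h : ¬ Alive F m i) :
    F m i j = false := by
  simp only [Alive, not_forall, Bool.not_eq_true] at h
  obtain ⟨k, hk, hki⟩ := h
  exact hF.2.1 k i hki m hk j

theorem alive_of_delivered (hF : F ∈ Crash n t) (h : F m i j = true) : Alive F m i := by
  by_contra hi
  simp [not_delivered_of_not_alive hF hi] at h

open Classical in
/-- The agents that have crashed by time `m`. -/
noncomputable def dead (F : FailurePattern n) (m : ℕ) : Finset (Fin n) := {i | ¬ Alive F m i}

theorem mem_dead : i ∈ dead F m ↔ ¬ Alive F m i := by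
  simp [dead]

theorem dead_subset_succ : dead F m ⊆ dead F (m + 1) := by
  intro i hi
  rw [mem_dead] at hi ⊢
  exact fun h => hi (h.mono m.le_succ)

theorem card_dead_le (hF : F ∈ Crash n t) (m : ℕ) : #(dead F m) ≤ t := by
  refine le_trans ?_ hF.2.2
  rw [← Set.ncard_coe_finset]
  refine Set.ncard_le_ncard (fun i hi => ?_) (Set.toFinite _)
  have hi' := mem_dead.mp hi
  simp only [Alive, not_forall, Bool.not_eq_true] at hi'
  obtain ⟨k, -, hk⟩ := hi'
  exact ⟨k, i, hk⟩

theorem exists_alive_ne (hn : t + 2 ≤ n) (hF : F ∈ Crash n t) (m : ℕ) (j : Fin n) :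
    ∃ i ≠ j, Alive F m i := by
  by_contra! h
  have hsub : (Finset.univ : Finset (Fin n)) ⊆ insert j (dead F m) := fun i _ =>
    Finset.mem_insert.mpr (or_iff_not_imp_left.mpr fun hi => mem_dead.mpr (h i hi))
  have hcard := (Finset.card_le_card hsub).trans (Finset.card_insert_le j _)
  have := card_dead_le hF m
  rw [Finset.card_univ, Fintype.card_fin] at hcard
  omega

theorem card_dead_add_two_le (hij : i ≠ j) (hi : Alive F m i) (hj : Alive F m j) :
    #(dead F m) + 2 ≤ n := by
  have hsub : {i, j} ⊆ (dead F m)ᶜ := by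
    simp [Finset.insert_subset_iff, mem_dead, hi, hj]
  have hcard := Finset.card_le_card hsub
  rw [Finset.card_pair hij, Finset.card_compl, Fintype.card_fin] at hcard
  omega

/-! ### Local states in closed form -/

/-- The set of values seen by agent `i` at time `m`, provided that `i` is alive then. -/
def vals (F : FailurePattern n) (v : Fin n → Value) : ℕ → Fin n → Finset Value
  | 0, i => {v i}
  | m + 1, i => ({j | F m j i = true} : Finset (Fin n)).biUnion (vals F v m)

/-- The number of messages that agent `i` misses in round `m`. There is no round `0`. -/
def lost (F : FailurePattern n) : ℕ → Fin n → ℕ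
  | 0, _ => 0
  | m + 1, i => #{j | F m j i = false}

/-- The waste estimate of agent `i` at time `m`, provided that `i` is alive then. -/
def est (F : FailurePattern n) : ℕ → Fin n → ℤ
  | 0, _ => 0
  | m + 1, i => ({j | F m j i = true} : Finset (Fin n)).fold max
      (max (est F m i) ((lost F (m + 1) i : ℤ) - ((m + 1 : ℕ) : ℤ))) (est F m)

open Classical in
/-- The local state of agent `i` at time `m`, as a function of the failure pattern and the initial
values; it does not depend on the decision protocol. -/
noncomputable def state (F : FailurePattern n) (v : Fin n → Value) (m : ℕ) (i : Fin n) :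
    SendWasteState :=
  if Alive F m i then .active (vals F v m i) (lost F m i) (est F m i) m (v i) else .crashed

theorem state_of_alive (h : Alive F m i) :
    state F v m i = .active (vals F v m i) (lost F m i) (est F m i) m (v i) := if_pos h

theorem state_of_not_alive (h : ¬ Alive F m i) : state F v m i = .crashed := if_neg h

theorem state_ne_crashed_iff : state F v m i ≠ .crashed ↔ Alive F m i := by
  by_cases h : Alive F m i
  · simp [state_of_alive h, h]
  · simp [state_of_not_alive h, h]

theorem mem_vals_succ {x : Value} :
    x ∈ vals F v (m + 1) i ↔ ∃ j, F m j i = true ∧ x ∈ vals F v m j := by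
  simp [vals]

theorem lost_succ_le_card {A : Finset (Fin n)} (h : ∀ j, F m j i = false → j ∈ A) :
    lost F (m + 1) i ≤ #A :=
  Finset.card_le_card fun j hj => h j (by simpa using hj)

theorem card_le_lost_succ {A : Finset (Fin n)} (h : ∀ j ∈ A, F m j i = false) :
    #A ≤ lost F (m + 1) i :=
  Finset.card_le_card fun j hj => by simpa using h j hj

theorem est_succ_le_iff {x : ℤ} :
    est F (m + 1) i ≤ x ↔ est F m i ≤ x ∧ (lost F (m + 1) i : ℤ) - ((m + 1 : ℕ) : ℤ) ≤ x ∧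
      ∀ j, F m j i = true → est F m j ≤ x := by
  rw [est, Finset.fold_max_le]
  simp [and_assoc]

theorem le_est_succ_iff {x : ℤ} :
    x ≤ est F (m + 1) i ↔ (x ≤ est F m i ∨ x ≤ (lost F (m + 1) i : ℤ) - ((m + 1 : ℕ) : ℤ)) ∨
      ∃ j, F m j i = true ∧ x ≤ est F m j := by
  rw [est, Finset.le_fold_max, le_max_iff]
  simp

/-- The messages that agent `i` receives in round `m + 1`. -/
def inbox (F : FailurePattern n) (v : Fin n → Value) (m : ℕ) (i : Fin n) :
    Fin n → Option Message :=
  fun j => if F m j i = true then some (vals F v m j, est F m j) else none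

theorem inbox_eq (hF : F ∈ Crash n t) :
    (fun j => if F m j i = true then send (state F v m j) else none) = inbox F v m i := by
  funext j
  refine ite_congr rfl (fun h => ?_) fun _ => rfl
  rw [state_of_alive (alive_of_delivered hF h)]
  rfl

theorem receivedValues_inbox : receivedValues (inbox F v m i) = vals F v (m + 1) i := by
  ext x
  rw [mem_vals_succ, receivedValues, Finset.mem_biUnion]
  refine exists_congr fun j => ?_
  by_cases h : F m j i = true <;> simp [inbox, h]

theorem missing_inbox : missing (inbox F v m i) = lost F (m + 1) i := by
  refine congrArg Finset.card (Finset.filter_congr fun j _ => ?_)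
  by_cases h : F m j i = true <;> simp [inbox, h]

theorem newEstimate_inbox : newEstimate (est F m i) (m + 1) (inbox F v m i) = est F (m + 1) i := by
  refine eq_of_forall_ge_iff fun x => ?_
  rw [newEstimate, Finset.fold_max_le, max_le_iff, est_succ_le_iff, missing_inbox, and_assoc]
  refine and_congr_right fun hi => and_congr_right fun _ => forall_congr' fun j => ?_
  by_cases h : F m j i = true <;> simp [inbox, h, hi]

theorem update_state (hF : F ∈ Crash n t) :
    update i (state F v m i) F (fun j => if F m j i = true then send (state F v m j) else none) =
      state F v (m + 1) i := by
  rw [inbox_eq hF]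
  by_cases hi : Alive F m i
  · rw [state_of_alive hi]
    by_cases hc : F m i i = true
    · rw [state_of_alive (alive_succ.mpr ⟨hi, hc⟩)]
      simp only [update, hc, Bool.true_eq_false, if_false, receivedValues_inbox, missing_inbox,
        newEstimate_inbox]
    · rw [state_of_not_alive fun h => hc (alive_succ.mp h).2]
      simp [update, hc]
  · rw [state_of_not_alive hi, state_of_not_alive fun h => hi (alive_succ.mp h).1]
    rfl

section Runs

variable {P : DecisionProtocol (sendWaste n)} {r : Run (sendWaste n)}

/-- The initial values of a run. -/
def inits (r : Run (sendWaste n)) : Fin n → Value := fun i => init ((r 0).loc i)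

theorem loc_eq_state (hr : r ∈ system (sendWaste n) t P) (m : ℕ) (i : Fin n) :
    (r m).loc i = state (r 0).env (inits r) m i := by
  have hr' : IsRun (sendWaste n) t P r := hr
  induction m generalizing i with
  | zero =>
    obtain ⟨x, hx⟩ := hr'.initial i
    have hinit : inits r i = x := congrArg init hx
    rw [state_of_alive alive_zero]
    simp only [vals, lost, est, hinit]
    exact hx
  | succ m ih =>
    rw [hr'.step m i, hr'.env_const m, ← update_state hr'.env_mem, ih i]
    simp only [ih]
    rfl

theorem mem_nonfailed_iff (hr : r ∈ system (sendWaste n) t P) :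
    i ∈ nonfailed (sendWaste n) r m ↔ Alive (r 0).env m i := by
  rw [← state_ne_crashed_iff (v := inits r), ← loc_eq_state hr m i]
  exact mem_nonfailed

theorem wasteEstimate_loc (hr : r ∈ system (sendWaste n) t P) (hi : Alive (r 0).env m i) :
    wasteEstimate ((r m).loc i) = est (r 0).env m i := by
  rw [loc_eq_state hr m i, state_of_alive hi]
  rfl

/-- A failure pattern together with initial values: the data that determine a run. -/
abbrev Scenario (n : ℕ) : Type := FailurePattern n × (Fin n → Value)

/-- The run determined by a scenario. -/
noncomputable def runOf (a : Scenario n) : Run (sendWaste n) := fun m => ⟨a.1, state a.1 a.2 m⟩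

theorem runOf_mem_system {a : Scenario n} (ha : a.1 ∈ Crash n t)
    (P : DecisionProtocol (sendWaste n)) : runOf a ∈ system (sendWaste n) t P where
  env_mem := ha
  env_const _ := rfl
  initial i := ⟨a.2 i, state_of_alive alive_zero⟩
  step _ _ := (update_state ha).symm

theorem inits_runOf (a : Scenario n) : inits (runOf a) = a.2 := by
  funext i
  exact congrArg init (state_of_alive alive_zero)

end Runs

/-! ### Estimates, seen values and clean rounds -/

theorem est_mono (F : FailurePattern n) (i : Fin n) : Monotone fun m => est F m i :=
  monotone_nat_of_le_succ fun _ => (est_succ_le_iff.mp le_rfl).1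

theorem est_nonneg (F : FailurePattern n) (m : ℕ) (i : Fin n) : 0 ≤ est F m i :=
  est_mono F i m.zero_le

theorem est_le_of_delivered (h : F m j i = true) : est F m j ≤ est F (m + 1) i :=
  (est_succ_le_iff.mp le_rfl).2.2 j h

theorem lost_sub_le_est (F : FailurePattern n) (m : ℕ) (i : Fin n) :
    (lost F m i : ℤ) - m ≤ est F m i := by
  cases m with
  | zero => simp [lost, est]
  | succ m => exact (est_succ_le_iff.mp le_rfl).2.1

theorem lost_le_card_dead (hF : F ∈ Crash n t) (m : ℕ) (i : Fin n) : lost F m i ≤ #(dead F m) := by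
  cases m with
  | zero => exact Nat.zero_le _
  | succ m =>
    refine lost_succ_le_card fun j hj => mem_dead.mpr fun h => ?_
    simp [h.delivered hF] at hj

theorem mem_vals_self (h : Alive F m i) : v i ∈ vals F v m i := by
  induction m with
  | zero => simp [vals]
  | succ m ih => exact mem_vals_succ.mpr ⟨i, (alive_succ.mp h).2, ih (alive_succ.mp h).1⟩

theorem exists_init_of_mem_vals {x : Value} (h : x ∈ vals F v m i) : ∃ j, v j = x := by
  induction m generalizing i with
  | zero => exact ⟨i, by simpa [vals, eq_comm] using h⟩
  | succ m ih =>
    obtain ⟨j, -, hj⟩ := mem_vals_succ.mp h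
    exact ih hj

theorem vals_eq_of_common {W : Finset Value} {k : ℕ} (hF : F ∈ Crash n t) (hkm : k ≤ m)
    (h : ∀ i, Alive F k i → vals F v k i = W) (hi : Alive F m i) : vals F v m i = W := by
  induction m, hkm using Nat.le_induction generalizing i with
  | base => exact h i hi
  | succ m _ ih =>
    obtain ⟨hi, hii⟩ := alive_succ.mp hi
    ext x
    rw [mem_vals_succ]
    constructor
    · rintro ⟨j, hj, hx⟩
      rwa [ih (alive_of_delivered hF hj)] at hx
    · exact fun hx => ⟨i, hii, by rwa [ih hi]⟩

theorem exists_origin_of_est (hF : F ∈ Crash n t) (hi : Alive F m i) :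
    ∃ k ≤ m, est F m i + k ≤ #(dead F k) ∧
      ∀ l, k ≤ l → l ≤ m → ∃ j, Alive F l j ∧ est F m i ≤ est F l j := by
  induction m generalizing i with
  | zero =>
    refine ⟨0, le_rfl, by simp [est], fun l _ hl => ⟨i, hi.mono hl, ?_⟩⟩
    rw [Nat.le_zero.mp hl]
  | succ m ih =>
    have inherited : ∀ j, Alive F m j → est F (m + 1) i ≤ est F m j →
        ∃ k ≤ m + 1, est F (m + 1) i + k ≤ #(dead F k) ∧
          ∀ l, k ≤ l → l ≤ m + 1 → ∃ j, Alive F l j ∧ est F (m + 1) i ≤ est F l j := by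
      intro j hj hle
      obtain ⟨k, hk, hdead, hheld⟩ := ih hj
      refine ⟨k, by omega, by omega, fun l hkl hlm => ?_⟩
      rcases Nat.le_succ_iff.mp hlm with hlm | rfl
      · obtain ⟨x, hx, hx'⟩ := hheld l hkl hlm
        exact ⟨x, hx, hle.trans hx'⟩
      · exact ⟨i, hi, le_rfl⟩
    rcases le_est_succ_iff.mp le_rfl with (hown | hlost) | ⟨j, hj, hle⟩
    · exact inherited i (alive_succ.mp hi).1 hown
    · have := lost_le_card_dead hF (m + 1) i
      refine ⟨m + 1, le_rfl, by omega, fun l hl hl' => ?_⟩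
      obtain rfl := le_antisymm hl' hl
      exact ⟨i, hi, le_rfl⟩
    · exact inherited j (alive_of_delivered hF hj) hle

/-- Round `k + 1` is clean: no agent crashes in it. -/
def IsClean (F : FailurePattern n) (k : ℕ) : Prop := dead F (k + 1) = dead F k

theorem IsClean.delivered_iff {k : ℕ} (hF : F ∈ Crash n t) (hk : IsClean F k) :
    F k j i = true ↔ Alive F k j := by
  refine ⟨alive_of_delivered hF, fun h => Alive.delivered hF ?_⟩
  have hj : j ∉ dead F (k + 1) := by
    rw [show dead F (k + 1) = dead F k from hk, mem_dead]
    exact not_not.mpr h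
  exact not_not.mp (mt mem_dead.mpr hj)

theorem IsClean.vals_eq {k : ℕ} (hF : F ∈ Crash n t) (hk : IsClean F k) (i j : Fin n) :
    vals F v (k + 1) i = vals F v (k + 1) j := by
  ext x
  simp only [mem_vals_succ, hk.delivered_iff hF]

theorem card_dead_add_le_of_no_clean {k : ℕ} (hkm : k ≤ m)
    (h : ∀ l, k ≤ l → l < m → ¬ IsClean F l) : #(dead F k) + (m - k) ≤ #(dead F m) := by
  induction m, hkm using Nat.le_induction with
  | base => simp
  | succ m hkm ih =>
    have hk := ih fun l hkl hlm => h l hkl (by omega)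
    have hm := Finset.card_lt_card
      (dead_subset_succ.ssubset_of_ne (Ne.symm (h m hkm m.lt_succ_self)))
    omega

/-- The condition under which the protocol `P^send` lets agent `i` decide at time `m`. -/
def Ready (t : ℕ) (F : FailurePattern n) (m : ℕ) (i : Fin n) : Prop :=
  (m : ℤ) ≥ min ((t : ℤ) + 1) ((n : ℤ) - 1) - est F m i

theorem Ready.exists_clean_or_unique (hF : F ∈ Crash n t) (hi : Alive F m i)
    (h : Ready t F m i) :
    (∃ l < m, IsClean F l ∧ ∃ x, Alive F l x ∧ est F m i ≤ est F l x) ∨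
      ∀ j, Alive F m j → j = i := by
  obtain ⟨k, hkm, hdead, hheld⟩ := exists_origin_of_est hF hi
  by_cases hc : ∃ l, k ≤ l ∧ l < m ∧ IsClean F l
  · obtain ⟨l, hkl, hlm, hclean⟩ := hc
    exact Or.inl ⟨l, hlm, hclean, hheld l hkl hlm.le⟩
  · refine Or.inr fun j hj => ?_
    by_contra hji
    have := card_dead_add_le_of_no_clean hkm fun l hkl hlm hl => hc ⟨l, hkl, hlm, hl⟩
    have := card_dead_le hF m
    have := card_dead_add_two_le hji hj hi
    unfold Ready at h
    omega

theorem Ready.vals_eq (hF : F ∈ Crash n t) (hi : Alive F m i) (hj : Alive F m j)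
    (h : Ready t F m i) : vals F v m i = vals F v m j := by
  rcases h.exists_clean_or_unique hF hi with ⟨l, hlm, hl, -⟩ | huniq
  · have common := fun x (_ : Alive F (l + 1) x) => hl.vals_eq (v := v) hF x i
    rw [vals_eq_of_common hF hlm common hi, vals_eq_of_common hF hlm common hj]
  · rw [huniq j hj]

theorem Ready.of_alive (hF : F ∈ Crash n t) (hi : Alive F m i) (hj : Alive F m j)
    (h : Ready t F m i) : Ready t F m j := by
  rcases h.exists_clean_or_unique hF hi with ⟨l, hlm, hl, x, hx, hle⟩ | huniq
  · have hrecv : est F l x ≤ est F (l + 1) j := est_le_of_delivered ((hl.delivered_iff hF).mpr hx)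
    have hkept : est F (l + 1) j ≤ est F m j := est_mono F j hlm
    unfold Ready at h ⊢
    omega
  · rwa [huniq j hj]

/-! ### Indistinguishability -/

/-- Agent `i` has the same active local state in the scenarios `(F, v)` and `(F', v')` at time `m`,
provided that it is alive in both. -/
structure SameView (F F' : FailurePattern n) (v v' : Fin n → Value) (m : ℕ) (i : Fin n) :
    Prop where
  vals : vals F v m i = vals F' v' m i
  lost : lost F m i = lost F' m i
  est : est F m i = est F' m i
  init : v i = v' i

theorem sameView_zero (h : v i = v' i) : SameView F F' v v' 0 i :=
  ⟨by simp [vals, h], rfl, rfl, h⟩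

theorem SameView.succ (hi : SameView F F' v v' m i) (agree : ∀ j, F m j i = F' m j i)
    (h : ∀ j, F m j i = true → SameView F F' v v' m j) : SameView F F' v v' (m + 1) i := by
  have hlost : SendWaste.lost F (m + 1) i = SendWaste.lost F' (m + 1) i := by
    simp only [SendWaste.lost, agree]
  refine ⟨?_, hlost, ?_, hi.init⟩
  · ext x
    simp only [mem_vals_succ, ← agree]
    exact exists_congr fun j => and_congr_right fun hj => by rw [(h j hj).vals]
  · refine eq_of_forall_ge_iff fun x => ?_
    simp only [est_succ_le_iff, ← agree, hlost, hi.est]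
    refine and_congr_right fun _ => and_congr_right fun _ => forall_congr' fun j => ?_
    exact forall_congr' fun hj => by rw [(h j hj).est]

theorem sameView_of_hidden {b : ℕ} (hbm : b ≤ m) {X : ℕ → Set (Fin n)} (hX : Monotone X)
    (hb : ∀ i ∉ X b, SameView F F' v v' b i)
    (agree : ∀ k, b ≤ k → k < m → ∀ i ∉ X (k + 1), ∀ j, F k j i = F' k j i)
    (hidden : ∀ k, b ≤ k → k < m → ∀ i ∉ X (k + 1), ∀ j ∈ X k, F k j i = false)
    (hi : i ∉ X m) : SameView F F' v v' m i := by
  induction m, hbm using Nat.le_induction generalizing i with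
  | base => exact hb i hi
  | succ m hbm ih =>
    have view : ∀ j ∉ X m, SameView F F' v v' m j := fun j hj =>
      ih (fun k hbk hkm => agree k hbk (by omega)) (fun k hbk hkm => hidden k hbk (by omega)) hj
    refine (view i fun h => hi (hX m.le_succ h)).succ (agree m hbm m.lt_succ_self i hi)
      fun j hj => view j fun hjX => ?_
    simp [hidden m hbm m.lt_succ_self i hi j hjX] at hj

theorem sameView_of_eqOn (v : Fin n → Value) (h : ∀ k < m, F k = F' k) (i : Fin n) :
    SameView F F' v v m i :=
  sameView_of_hidden (X := fun _ => ∅) m.zero_le monotone_const (fun _ _ => sameView_zero rfl)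
    (fun k _ hk _ _ _ => by rw [h k hk]) (fun _ _ _ _ _ _ h => absurd h (Set.notMem_empty _))
    (Set.notMem_empty i)

theorem sameView_of_silent {b : ℕ} (hv : ∀ i, (i = j → 0 < b) → v i = v' i)
    (silent : ∀ k < m, b ≤ k → ∀ x, F k j x = false)
    (agree : ∀ k < m, ∀ x y, (y = j → k + 1 < b) → F k x y = F' k x y) (hi : i ≠ j) :
    SameView F F' v v' m i := by
  refine sameView_of_hidden (X := fun k => {x | x = j ∧ b ≤ k}) m.zero_le ?_ ?_ ?_ ?_
    fun h => hi h.1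
  · exact fun k l hkl x hx => ⟨hx.1, hx.2.trans hkl⟩
  · exact fun x hx => sameView_zero (hv x fun h => not_le.mp fun hb => hx ⟨h, hb⟩)
  · exact fun k _ hk x hx y => agree k hk y x fun h => not_le.mp fun hb => hx ⟨h, hb⟩
  · rintro k - hk x - _ ⟨rfl, hb⟩
    exact silent k hk hb x

/-- Some agent that is nonfailed in both scenarios cannot tell them apart at time `m`. -/
def Indistinguishable (t m : ℕ) (a b : Scenario n) : Prop :=
  a.1 ∈ Crash n t ∧ b.1 ∈ Crash n t ∧
    ∃ i, Alive a.1 m i ∧ Alive b.1 m i ∧ state a.1 a.2 m i = state b.1 b.2 m i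

/-- The scenarios are joined by a chain of indistinguishable ones, all with at most `t` failures;
common knowledge at time `m` does not change along such a chain. -/
def Reachable (t m : ℕ) : Scenario n → Scenario n → Prop :=
  Relation.EqvGen (Indistinguishable t m)

theorem Reachable.refl (a : Scenario n) : Reachable t m a a := Relation.EqvGen.refl a

theorem Reachable.symm {a b : Scenario n} (h : Reachable t m a b) : Reachable t m b a :=
  Relation.EqvGen.symm _ _ h

theorem Reachable.trans {a b c : Scenario n} (h : Reachable t m a b) (h' : Reachable t m b c) :
    Reachable t m a c :=
  Relation.EqvGen.trans _ _ _ h h'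

theorem Reachable.mono {t' : ℕ} (htt' : t ≤ t') {a b : Scenario n} (h : Reachable t m a b) :
    Reachable t' m a b :=
  Relation.EqvGen.mono (fun _ _ ⟨ha, hb, hi⟩ =>
    ⟨crash_subset_crash htt' ha, crash_subset_crash htt' hb, hi⟩) _ _ h

theorem reachable_of_sameView (hF : F ∈ Crash n t) (hF' : F' ∈ Crash n t) (hi : Alive F m i)
    (hi' : Alive F' m i) (h : SameView F F' v v' m i) : Reachable t m (F, v) (F', v') := by
  refine Relation.EqvGen.rel _ _ ⟨hF, hF', i, hi, hi', ?_⟩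
  simp only [state_of_alive hi, state_of_alive hi', h.vals, h.lost, h.est, h.init]

theorem reachable_of_silent {b : ℕ} (hn : t + 2 ≤ n) (hF : F ∈ Crash n t) (hF' : F' ∈ Crash n t)
    (hv : ∀ i, (i = j → 0 < b) → v i = v' i) (silent : ∀ k < m, b ≤ k → ∀ x, F k j x = false)
    (agree : ∀ k < m, ∀ x y, (y = j → k + 1 < b) → F k x y = F' k x y) :
    Reachable t m (F, v) (F', v') := by
  obtain ⟨i, hij, hi⟩ := exists_alive_ne hn hF m j
  have hi' : Alive F' m i := fun k hk => by
    rw [← agree k hk i i fun h => absurd h hij, hi k hk]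
  exact reachable_of_sameView hF hF' hi hi' (sameView_of_silent hv silent agree hij)

theorem Reachable.commonKnowledge_iff {P : DecisionProtocol (sendWaste n)}
    {φ : PointProp (sendWaste n)} {a b : Scenario n} (h : Reachable t m a b) :
    CommonKnowledge (system (sendWaste n) t P) φ (runOf a) m ↔
      CommonKnowledge (system (sendWaste n) t P) φ (runOf b) m := by
  induction h with
  | rel a b h =>
    obtain ⟨ha, hb, i, hia, hib, hst⟩ := h
    have ra := runOf_mem_system ha P
    have rb := runOf_mem_system hb P
    exact ⟨fun hc => hc.of_loc_eq ((mem_nonfailed_iff ra).mpr hia) rb hst,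
      fun hc => hc.of_loc_eq ((mem_nonfailed_iff rb).mpr hib) ra hst.symm⟩
  | refl => exact Iff.rfl
  | symm _ _ _ ih => exact ih.symm
  | trans _ _ _ _ _ ih ih' => exact ih.trans ih'

/-! ### Crash schedules -/

/-- For each agent, the time at which the round of its crash starts and the agents that its last
messages, sent in that round, still reach. -/
abbrev Schedule (n : ℕ) : Type := Fin n → ℕ × Finset (Fin n)

/-- The failure pattern in which the agents crash according to the schedule `s`, except that
crashes scheduled at time `m` or later do not take place. -/
def pattern (m : ℕ) (s : Schedule n) : FailurePattern n :=
  fun k i j => decide (m ≤ (s i).1 ∨ k < (s i).1 ∨ k = (s i).1 ∧ j ∈ (s i).2 ∧ j ≠ i)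

/-- The agents that crash before time `m` according to the schedule `s`. -/
def crashing (m : ℕ) (s : Schedule n) : Finset (Fin n) := {i | (s i).1 < m}

variable {s s' : Schedule n} {b k : ℕ} {S : Finset (Fin n)}

theorem mem_crashing : i ∈ crashing m s ↔ (s i).1 < m := by
  simp [crashing]

theorem pattern_eq_true_iff : pattern m s k i j = true ↔
    m ≤ (s i).1 ∨ k < (s i).1 ∨ k = (s i).1 ∧ j ∈ (s i).2 ∧ j ≠ i :=
  decide_eq_true_iff

theorem pattern_eq_false_iff : pattern m s k i j = false ↔
    (s i).1 < m ∧ (s i).1 ≤ k ∧ (k = (s i).1 → j ∈ (s i).2 → j = i) := by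
  rw [pattern, decide_eq_false_iff_not]
  push Not
  rfl

theorem pattern_eq_true_of_le (h : m ≤ (s i).1) : pattern m s k i j = true :=
  pattern_eq_true_iff.mpr (Or.inl h)

theorem pattern_eq_false_of_lt (h : (s i).1 < m) (hk : (s i).1 < k) : pattern m s k i j = false :=
  pattern_eq_false_iff.mpr ⟨h, hk.le, fun h => absurd h hk.ne'⟩

theorem alive_pattern_iff : Alive (pattern m s) m i ↔ m ≤ (s i).1 := by
  refine ⟨fun h => ?_, fun h _ _ => pattern_eq_true_of_le h⟩
  by_contra! hi
  have hcrash := pattern_eq_false_iff (j := i).mpr ⟨hi, le_rfl, fun _ _ => rfl⟩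
  exact Bool.false_ne_true (hcrash.symm.trans (h _ hi))

theorem pattern_congr (h : ∀ i, m ≤ (s i).1 ∧ m ≤ (s' i).1 ∨ s i = s' i) :
    pattern m s = pattern m s' := by
  funext k i j
  rw [Bool.eq_iff_iff, pattern_eq_true_iff, pattern_eq_true_iff]
  rcases h i with ⟨hs, hs'⟩ | hs
  · simp only [hs, hs', true_or]
  · rw [hs]

theorem pattern_update_of_le (h : m ≤ (s j).1) :
    pattern m (Function.update s j (m, S)) = pattern m s := by
  refine pattern_congr fun i => ?_
  rcases eq_or_ne i j with rfl | hij
  · simp [h]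
  · simp [hij]

theorem pattern_congr_of_eq (h : s i = s' i) : pattern m s k i j = pattern m s' k i j := by
  simp only [pattern, h]

theorem pattern_mem_crash (h : #(crashing m s) ≤ t) : pattern m s ∈ Crash n t := by
  refine ⟨fun k i j hk => ?_, fun k i hk k' hk' j => ?_, ?_⟩
  · rw [pattern_eq_false_iff] at hk ⊢
    exact ⟨hk.1, hk.2.1, fun _ _ => rfl⟩
  · rw [pattern_eq_false_iff] at hk
    exact pattern_eq_false_of_lt hk.1 (hk.2.1.trans_lt hk')
  · refine le_trans ?_ h
    rw [← Set.ncard_coe_finset]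
    refine Set.ncard_le_ncard ?_ (Set.toFinite _)
    rintro i ⟨k, j, hk⟩
    exact mem_crashing.mpr (pattern_eq_false_iff.mp hk).1

theorem crashing_update_of_lt (h : b < m) :
    crashing m (Function.update s j (b, S)) = insert j (crashing m s) := by
  ext i
  rcases eq_or_ne i j with rfl | hij
  · simp [mem_crashing, h]
  · simp [mem_crashing, hij]

theorem crashing_update_of_le (h : m ≤ b) :
    crashing m (Function.update s j (b, S)) = (crashing m s).erase j := by
  ext i
  rcases eq_or_ne i j with rfl | hij
  · simp [mem_crashing, h]
  · simp [mem_crashing, hij]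

/-! ### Undoing crashes -/

/-- According to `s`, the crashes that take place before time `m` all take place before time `b`,
and a further crash in each of the rounds between `b` and `m` is within the bound `t`. -/
structure HasRoom (t m b : ℕ) (s : Schedule n) : Prop where
  settled : ∀ i, (s i).1 < b ∨ m ≤ (s i).1
  card_add_le : #(crashing m s) + m ≤ t + b

theorem HasRoom.pattern_mem_crash (hs : HasRoom t m b s) (hb : b ≤ m) :
    pattern m s ∈ Crash n t := by
  have := hs.card_add_le
  exact SendWaste.pattern_mem_crash (by omega)

theorem HasRoom.succ (hs : HasRoom t m b s) : HasRoom t m (b + 1) s where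
  settled i := (hs.settled i).imp_left Nat.lt_succ_of_lt
  card_add_le := hs.card_add_le.trans (Nat.le_succ _)

theorem HasRoom.crash_now (hs : HasRoom t m b s) (hb : b < m) (j : Fin n) (S : Finset (Fin n)) :
    HasRoom t m (b + 1) (Function.update s j (b, S)) where
  settled i := by
    rcases eq_or_ne i j with rfl | hij
    · simp
    · simpa [hij] using hs.succ.settled i
  card_add_le := by
    rw [crashing_update_of_lt hb]
    have := Finset.card_insert_le j (crashing m s)
    have := hs.card_add_le
    omega

theorem HasRoom.uncrash (hs : HasRoom t m b s) (i : Fin n) :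
    HasRoom t m b (Function.update s i (m, ∅)) where
  settled x := by
    rcases eq_or_ne x i with rfl | hxi
    · simp
    · simpa [hxi] using hs.settled x
  card_add_le := by
    rw [crashing_update_of_le le_rfl]
    have := Finset.card_erase_le (s := crashing m s) (a := i)
    have := hs.card_add_le
    omega

theorem HasRoom.change_recipients (hs : HasRoom t m (b + 1) s) (hb : b < m) (hi : (s i).1 = b)
    (S : Finset (Fin n)) : HasRoom t m (b + 1) (Function.update s i (b, S)) where
  settled x := by
    rcases eq_or_ne x i with rfl | hxi
    · simp
    · simpa [hxi] using hs.settled x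
  card_add_le := by
    rw [crashing_update_of_lt hb, Finset.insert_eq_of_mem (mem_crashing.mpr (hi ▸ hb))]
    exact hs.card_add_le

theorem HasRoom.pattern_crash_now_mem (hs : HasRoom t m b s) (hb : b ≤ m) (j : Fin n)
    (S : Finset (Fin n)) : pattern m (Function.update s j (b, S)) ∈ Crash n t := by
  rcases hb.lt_or_eq with hb | rfl
  · exact (hs.crash_now hb j S).pattern_mem_crash hb
  · refine SendWaste.pattern_mem_crash ?_
    rw [crashing_update_of_le le_rfl]
    have := Finset.card_erase_le (s := crashing b s) (a := j)
    have := hs.card_add_le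
    omega

/-- At time `b`, while there is room, any live agent can be made to crash without sending anything
from then on, up to reachability. -/
def CanSilence (t m : ℕ) (v : Fin n → Value) (b : ℕ) : Prop :=
  ∀ ⦃s : Schedule n⦄ ⦃j : Fin n⦄, HasRoom t m b s → m ≤ (s j).1 →
    Reachable t m (pattern m s, v) (pattern m (Function.update s j (b, ∅)), v)

theorem reachable_insert_recipient_of_silent (hn : t + 2 ≤ n) (hi : (s i).1 = b)
    (hs : pattern m s ∈ Crash n t)
    (hs' : pattern m (Function.update s i (b, insert j (s i).2)) ∈ Crash n t)
    (silent : ∀ k < m, b + 1 ≤ k → ∀ x, pattern m s k j x = false) :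
    Reachable t m (pattern m s, v)
      (pattern m (Function.update s i (b, insert j (s i).2)), v) := by
  refine reachable_of_silent hn hs hs' (fun _ _ => rfl) silent fun k _ x y hy => ?_
  rcases eq_or_ne x i with rfl | hxi
  · rw [Bool.eq_iff_iff, pattern_eq_true_iff, pattern_eq_true_iff]
    simp only [Function.update_self, hi, Finset.mem_insert]
    by_cases hyj : y = j
    · have := hy hyj
      simp only [show k < b by omega, true_or, or_true]
    · simp only [hyj, false_or]
  · exact pattern_congr_of_eq (Function.update_of_ne hxi _ _).symm

theorem CanSilence.reachable_insert_recipient (h : CanSilence t m v (b + 1)) (hn : t + 2 ≤ n)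
    (hb : b < m) (hs : HasRoom t m (b + 1) s) (hi : (s i).1 = b) (j : Fin n) :
    Reachable t m (pattern m s, v)
      (pattern m (Function.update s i (b, insert j (s i).2)), v) := by
  have hs' := hs.change_recipients hb hi (insert j (s i).2)
  rcases hs.settled j with hj | hj
  · refine reachable_insert_recipient_of_silent hn hi (hs.pattern_mem_crash hb)
      (hs'.pattern_mem_crash hb) fun k _ hk x => pattern_eq_false_of_lt ?_ ?_ <;> omega
  · have hij : i ≠ j := by
      rintro rfl
      omega
    have silenced := hs.pattern_crash_now_mem hb j ∅
    have silenced' := hs'.pattern_crash_now_mem hb j ∅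
    have undo := (h hs' (by rwa [Function.update_of_ne hij.symm])).symm
    rw [Function.update_comm hij] at silenced' undo
    have insertion := reachable_insert_recipient_of_silent (v := v) (b := b) hn
      (s := Function.update s j (b + 1, ∅)) (i := i) (j := j)
      (by rwa [Function.update_of_ne hij]) silenced
      (by rwa [Function.update_of_ne hij]) fun k hkm hk x => by
        simp only [pattern_eq_false_iff, Function.update_self, Finset.notMem_empty]
        exact ⟨by omega, hk, fun _ h => h.elim⟩
    rw [Function.update_of_ne hij] at insertion
    exact ((h hs hj).trans insertion).trans undo

theorem CanSilence.reachable_deliver_all (h : CanSilence t m v (b + 1)) (hn : t + 2 ≤ n)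
    (hb : b < m) (hs : HasRoom t m (b + 1) s) (hi : (s i).1 = b) :
    Reachable t m (pattern m s, v) (pattern m (Function.update s i (b, Finset.univ)), v) := by
  have union : ∀ R : Finset (Fin n), Reachable t m (pattern m s, v)
      (pattern m (Function.update s i (b, R ∪ (s i).2)), v) := by
    intro R
    induction R using Finset.induction_on with
    | empty =>
      rw [Finset.empty_union, ← hi, Prod.mk.eta, Function.update_eq_self]
      exact Reachable.refl _
    | insert j R _ ih =>
      have insertion := h.reachable_insert_recipient hn hb
        (hs.change_recipients hb hi (R ∪ (s i).2)) (i := i)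
        (by rw [Function.update_self]) j
      rw [Function.update_self, Function.update_idem] at insertion
      rw [Finset.insert_union]
      exact ih.trans insertion
  simpa only [Finset.union_eq_left.mpr (Finset.subset_univ _)] using union Finset.univ

/-- Once all messages of the crash are delivered, the crash can be postponed to the next round,
where it can be undone. -/
theorem CanSilence.reachable_uncrash (h : CanSilence t m v (b + 1)) (hn : t + 2 ≤ n)
    (hb : b < m) (hs : HasRoom t m (b + 1) s) (hi : (s i).1 = b) :
    Reachable t m (pattern m s, v) (pattern m (Function.update s i (m, ∅)), v) := by
  have hs' := hs.change_recipients hb hi Finset.univ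
  have postponed := (hs.uncrash i).pattern_crash_now_mem hb i ∅
  have undo := (h (hs.uncrash i) (j := i) (by rw [Function.update_self])).symm
  rw [Function.update_idem] at postponed undo
  refine (h.reachable_deliver_all hn hb hs hi).trans (Reachable.trans ?_ undo)
  refine reachable_of_silent (b := b + 1) (j := i) hn (hs'.pattern_mem_crash hb) postponed
    (fun _ _ => rfl) (fun k _ hk x => pattern_eq_false_of_lt ?_ ?_) fun k _ x y hy => ?_
  · rwa [Function.update_self]
  · rwa [Function.update_self]
  · rcases eq_or_ne x i with rfl | hxi
    · rw [Bool.eq_iff_iff, pattern_eq_true_iff, pattern_eq_true_iff]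
      simp only [Function.update_self, Finset.mem_univ, true_and, Finset.notMem_empty, false_and,
        and_false, or_false]
      omega
    · exact pattern_congr_of_eq (by rw [Function.update_of_ne hxi, Function.update_of_ne hxi])

theorem canSilence (hn : t + 2 ≤ n) (v : Fin n → Value) (hb : b ≤ m) : CanSilence t m v b := by
  induction hb using Nat.decreasingInduction with
  | self =>
    intro s j _ hj
    rw [pattern_update_of_le hj]
    exact Reachable.refl _
  | of_succ b hb ih =>
    intro s j hs hj
    have undo := ih.reachable_uncrash hn hb (hs.crash_now hb j ∅) (i := j)
      (by rw [Function.update_self])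
    rw [Function.update_idem, pattern_update_of_le hj] at undo
    exact undo.symm

theorem reachable_uncrash (hn : t + 2 ≤ n) (v : Fin n → Value) (hb : b < m)
    (hs : HasRoom t m (b + 1) s) (hi : (s i).1 = b) :
    Reachable t m (pattern m s, v) (pattern m (Function.update s i (m, ∅)), v) :=
  (canSilence hn v hb).reachable_uncrash hn hb hs hi

theorem sameView_of_uniform_round {L : Set (Fin n)} (hF : ∀ j, F m j i = true ↔ j ∈ L)
    (hF' : ∀ j, F' m j i = true ↔ j ∈ L) (hi : i ∈ L)
    (pooled_vals : ∀ x, (∃ j ∈ L, x ∈ vals F v m j) ↔ ∃ j ∈ L, x ∈ vals F' v m j)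
    (pooled_est : ∀ z, (∀ j ∈ L, est F m j ≤ z) ↔ ∀ j ∈ L, est F' m j ≤ z) :
    SameView F F' v v (m + 1) i := by
  have hlost : lost F (m + 1) i = lost F' (m + 1) i := by
    refine congrArg Finset.card (Finset.filter_congr fun j _ => ?_)
    rw [← Bool.not_eq_true, ← Bool.not_eq_true, hF, hF']
  refine ⟨?_, hlost, ?_, rfl⟩
  · ext x
    simpa only [mem_vals_succ, hF, hF'] using pooled_vals x
  · refine eq_of_forall_ge_iff fun z => ?_
    simp only [est_succ_le_iff, hF, hF', hlost, ← pooled_est]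
    refine ⟨fun ⟨_, hl, h⟩ => ⟨(pooled_est z).mp h i hi, hl, h⟩, fun ⟨_, hl, h⟩ => ⟨h i hi, hl, h⟩⟩

/-- The failure pattern `F`, except that all messages of `i` in round `k + 1` are delivered. It
serves to postpone a crash of `i` in round `k + 1` to the next round. -/
def deliverAll (F : FailurePattern n) (k : ℕ) (i : Fin n) : FailurePattern n :=
  Function.update F k (Function.update (F k) i ⊤)

theorem deliverAll_eq_true_iff {x l : Fin n} :
    deliverAll F k i k x l = true ↔ x = i ∨ F k x l = true := by
  rcases eq_or_ne x i with rfl | hxi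
  · simp [deliverAll]
  · simp [deliverAll, hxi]

theorem deliverAll_of_ne (h : b ≠ k) : deliverAll F k i b = F b :=
  Function.update_of_ne h _ _

theorem sameView_deliverAll (F : FailurePattern n) (v : Fin n → Value) (k : ℕ) (i j : Fin n) :
    SameView F (deliverAll F k i) v v k j :=
  sameView_of_eqOn v (fun _ hb => (deliverAll_of_ne hb.ne).symm) j

theorem sameView_deliverAll_succ {p : Fin n} (hp : F k i p = true) :
    SameView F (deliverAll F k i) v v (k + 1) p := by
  refine (sameView_deliverAll F v k i p).succ (fun j => ?_) fun j _ => sameView_deliverAll F v k i j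
  rw [Bool.eq_iff_iff, deliverAll_eq_true_iff]
  exact ⟨Or.inr, fun h => h.elim (fun h => h ▸ hp) id⟩

theorem lost_deliverAll_le (l : Fin n) : lost (deliverAll F k i) (k + 1) l ≤ lost F (k + 1) l :=
  card_le_lost_succ fun x hx => by
    simp only [Finset.mem_filter, Finset.mem_univ, true_and] at hx
    by_contra h
    simp [deliverAll_eq_true_iff.mpr (Or.inr (by simpa using h))] at hx

theorem pooled_vals_deliverAll {L : Set (Fin n)} {p : Fin n} (hp : F k i p = true) (hpL : p ∈ L)
    (x : Value) : (∃ l ∈ L, x ∈ vals F v (k + 1) l) ↔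
      ∃ l ∈ L, x ∈ vals (deliverAll F k i) v (k + 1) l := by
  simp only [mem_vals_succ, deliverAll_eq_true_iff, ← (sameView_deliverAll F v k i _).vals]
  constructor
  · rintro ⟨l, hl, j, hj, hx⟩
    exact ⟨l, hl, j, Or.inr hj, hx⟩
  · rintro ⟨l, hl, j, rfl | hj, hx⟩
    · exact ⟨p, hpL, j, hp, hx⟩
    · exact ⟨l, hl, j, hj, hx⟩

theorem pooled_est_deliverAll {L : Set (Fin n)} {p : Fin n} (hp : F k i p = true) (hpL : p ∈ L)
    (hmax : ∀ l ∈ L, lost F (k + 1) l ≤ lost F (k + 1) p) (z : ℤ) :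
    (∀ l ∈ L, est F (k + 1) l ≤ z) ↔ ∀ l ∈ L, est (deliverAll F k i) (k + 1) l ≤ z := by
  have same := fun j => (sameView_deliverAll F 0 k i j).est
  have same_p := sameView_deliverAll_succ (v := 0) hp
  constructor
  · intro h l hl
    obtain ⟨hown, hlost, hrecv⟩ := est_succ_le_iff.mp (h l hl)
    have := lost_deliverAll_le (F := F) (k := k) (i := i) l
    refine est_succ_le_iff.mpr ⟨same l ▸ hown, by omega, fun j hj => same j ▸ ?_⟩
    rcases deliverAll_eq_true_iff.mp hj with rfl | hj
    · exact (est_le_of_delivered hp).trans (h p hpL)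
    · exact hrecv j hj
  · intro h l hl
    obtain ⟨hown, -, hrecv⟩ := est_succ_le_iff.mp (h l hl)
    obtain ⟨-, hlost, -⟩ := est_succ_le_iff.mp (same_p.est ▸ h p hpL)
    have := hmax l hl
    refine est_succ_le_iff.mpr ⟨same l ▸ hown, by omega, fun j hj => same j ▸ ?_⟩
    exact hrecv j (deliverAll_eq_true_iff.mpr (Or.inr hj))

theorem pattern_postpone (hi : (s i).1 = b) (hb : b + 1 < m) :
    pattern m (Function.update s i (b + 1, ∅)) = deliverAll (pattern m s) b i := by
  funext k x l
  rcases eq_or_ne k b with rfl | hkb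
  · rw [Bool.eq_iff_iff, deliverAll_eq_true_iff, pattern_eq_true_iff, pattern_eq_true_iff]
    rcases eq_or_ne x i with rfl | hxi
    · simp
    · simp [hxi]
  · rw [deliverAll_of_ne hkb]
    rcases eq_or_ne x i with rfl | hxi
    · rw [Bool.eq_iff_iff, pattern_eq_true_iff, pattern_eq_true_iff]
      simp only [Function.update_self, Finset.notMem_empty, false_and, and_false, or_false]
      omega
    · exact pattern_congr_of_eq (Function.update_of_ne hxi _ _)

/-- The only agents that notice the postponement are those that miss fewer messages than before,
and in the next round `p` makes up for what they learn from `i` and for the misses they no longer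
report. -/
theorem reachable_postpone {p : Fin n} (settled : ∀ x, (s x).1 < b + 1 ∨ m ≤ (s x).1)
    (hs : #(crashing m s) ≤ t) (hb : b + 1 < m) (hi : (s i).1 = b) (hp : m ≤ (s p).1)
    (hip : p ∈ (s i).2)
    (hmax : ∀ l, m ≤ (s l).1 → lost (pattern m s) (b + 1) l ≤ lost (pattern m s) (b + 1) p) :
    Reachable t m (pattern m s, v) (pattern m (Function.update s i (b + 1, ∅)), v) := by
  have hpi : p ≠ i := by
    rintro rfl
    omega
  have delivered : pattern m s b i p = true :=
    pattern_eq_true_iff.mpr (Or.inr (Or.inr ⟨hi.symm, hip, hpi⟩))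
  have uniform : ∀ k, b < k → ∀ x l, pattern m s k x l = true ↔ x ∈ {x | m ≤ (s x).1} := by
    refine fun k hk x l => ⟨fun h => ?_, pattern_eq_true_of_le⟩
    have := settled x
    rw [pattern_eq_true_iff] at h
    rw [Set.mem_ofPred_eq]
    omega
  refine reachable_of_sameView (i := p) (pattern_mem_crash hs) (pattern_mem_crash ?_)
    (alive_pattern_iff.mpr hp) (alive_pattern_iff.mpr (by rwa [Function.update_of_ne hpi])) ?_
  · rwa [crashing_update_of_lt hb, Finset.insert_eq_of_mem (mem_crashing.mpr (by omega))]
  rw [pattern_postpone hi hb]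
  refine sameView_of_hidden (b := b + 2) (X := fun _ => {x | m ≤ (s x).1}ᶜ) hb monotone_const
    (fun l hl => ?_) (fun k hk _ l _ j => ?_) (fun k hk _ l _ j hj => ?_) (not_not.mpr hp)
  · refine sameView_of_uniform_round (uniform (b + 1) b.lt_succ_self · l) (fun j => ?_)
      (not_not.mp hl) (pooled_vals_deliverAll delivered hp)
      (pooled_est_deliverAll delivered hp hmax)
    rw [deliverAll_of_ne b.succ_ne_self]
    exact uniform (b + 1) b.lt_succ_self j l
  · rw [deliverAll_of_ne (by omega)]
  · exact Bool.eq_false_iff.mpr (mt (uniform k (by omega) j l).mp hj)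

theorem exists_reachable_uncrash (hn : t + 2 ≤ n) (v : Fin n → Value) (hb : b + 1 < m)
    (hs : HasRoom (t + 1) m (b + 1) s)
    (hlost : ∀ l, m ≤ (s l).1 → lost (pattern m s) (b + 1) l < #(crashing m s)) :
    ∃ i, (s i).1 = b ∧
      Reachable t m (pattern m s, v) (pattern m (Function.update s i (m, ∅)), v) := by
  have hcard := hs.card_add_le
  have hcrash : #(crashing m s) ≤ t := by omega
  obtain ⟨l, -, hl⟩ := exists_alive_ne hn (pattern_mem_crash hcrash) m ⟨0, by omega⟩
  obtain ⟨p, hp, hmax⟩ := Finset.exists_max_image {x | m ≤ (s x).1}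
    (lost (pattern m s) (b + 1)) ⟨l, by simpa using alive_pattern_iff.mp hl⟩
  simp only [Finset.mem_filter, Finset.mem_univ, true_and] at hp hmax
  obtain ⟨i, him, hip⟩ : ∃ i ∈ crashing m s, pattern m s b i p = true := by
    by_contra! hnone
    exact (hlost p hp).not_ge (card_le_lost_succ fun i hi => by simpa using hnone i hi)
  rw [mem_crashing] at him
  obtain ⟨hi, hip⟩ : (s i).1 = b ∧ p ∈ (s i).2 := by
    have := hs.settled i
    rcases pattern_eq_true_iff.mp hip with h | h | ⟨h, hmem, -⟩
    · omega
    · omega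
    · exact ⟨h.symm, hmem⟩
  have hroom : HasRoom t m (b + 2) (Function.update s i (b + 1, ∅)) := by
    refine ⟨fun x => ?_, ?_⟩
    · rcases eq_or_ne x i with rfl | hxi
      · simp
      · rw [Function.update_of_ne hxi]
        exact hs.succ.settled x
    · rw [crashing_update_of_lt hb, Finset.insert_eq_of_mem (mem_crashing.mpr him)]
      omega
  have undo := reachable_uncrash hn v hb hroom (i := i) (by rw [Function.update_self])
  rw [Function.update_idem] at undo
  exact ⟨i, hi, (reachable_postpone hs.settled hcrash hb hi hp hip hmax).trans undo⟩

/-! ### Undoing all crashes, latest first -/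

/-- The schedule `s` without the crashes scheduled at time `b` or later. -/
def truncate (m b : ℕ) (s : Schedule n) : Schedule n := fun i => if (s i).1 < b then s i else (m, ∅)

theorem truncate_of_lt (h : (s i).1 < b) : truncate m b s i = s i := if_pos h

theorem truncate_of_le (h : b ≤ (s i).1) : truncate m b s i = (m, ∅) := if_neg h.not_gt

theorem truncate_settled (m b : ℕ) (s : Schedule n) (i : Fin n) :
    (truncate m b s i).1 < b ∨ m ≤ (truncate m b s i).1 := by
  rcases lt_or_ge (s i).1 b with h | h
  · exact Or.inl (by rwa [truncate_of_lt h])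
  · exact Or.inr (by rw [truncate_of_le h])

theorem crashing_truncate (hb : b ≤ m) : crashing m (truncate m b s) = crashing b s := by
  ext i
  rw [mem_crashing, mem_crashing]
  rcases lt_or_ge (s i).1 b with h | h
  · simp only [truncate_of_lt h, h, h.trans_le hb]
  · simp only [truncate_of_le h, lt_irrefl, h.not_gt]

theorem truncate_truncate_succ (hb : b < m) :
    truncate m b (truncate m (b + 1) s) = truncate m b s := by
  funext i
  rcases lt_or_ge (s i).1 (b + 1) with h | h
  · simp only [truncate, h, if_true]
  · rw [truncate_of_le (truncate_of_le h ▸ hb.le), truncate_of_le (b.le_succ.trans h)]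

theorem truncate_uncrash (hb : b ≤ m) (hi : b ≤ (s i).1) :
    truncate m b (Function.update s i (m, ∅)) = truncate m b s := by
  funext x
  rcases eq_or_ne x i with rfl | hxi
  · rw [truncate_of_le hi, truncate_of_le (by rwa [Function.update_self])]
  · simp only [truncate, Function.update_of_ne hxi]

theorem pattern_truncate_of_lt (hk : k < b) : pattern m (truncate m b s) k = pattern m s k := by
  funext i j
  rcases lt_or_ge (s i).1 b with h | h
  · exact pattern_congr_of_eq (truncate_of_lt h)
  · rw [pattern_eq_true_of_le (by rw [truncate_of_le h]),
      pattern_eq_true_iff.mpr (Or.inr (Or.inl (hk.trans_le h)))]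

theorem pattern_truncate_of_settled (h : ∀ i, (s i).1 < b ∨ m ≤ (s i).1) :
    pattern m (truncate m b s) = pattern m s := by
  refine pattern_congr fun i => ?_
  rcases lt_or_ge (s i).1 b with hi | hi
  · exact Or.inr (truncate_of_lt hi)
  · have := h i
    exact Or.inl ⟨by rw [truncate_of_le hi], by omega⟩

theorem reachable_truncate_of_hasRoom (hn : t + 2 ≤ n) (v : Fin n → Value) (hb : b < m)
    (hs : HasRoom t m (b + 1) s) :
    Reachable t m (pattern m s, v) (pattern m (truncate m b s), v) := by
  induction hc : #(crashing m s) using Nat.strong_induction_on generalizing s with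
  | _ c ih =>
    by_cases hlast : ∃ i, (s i).1 = b
    · obtain ⟨i, hi⟩ := hlast
      have hlt : #(crashing m (Function.update s i (m, ∅))) < c := by
        rw [← hc, crashing_update_of_le le_rfl]
        exact Finset.card_erase_lt_of_mem (mem_crashing.mpr (hi ▸ hb))
      have rest := ih _ hlt (hs.uncrash i) rfl
      rw [truncate_uncrash hb.le hi.ge] at rest
      exact (reachable_uncrash hn v hb hs hi).trans rest
    · rw [pattern_truncate_of_settled fun i => ?_]
      · exact Reachable.refl _
      · have := hs.settled i
        have := not_exists.mp hlast i
        omega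

theorem reachable_truncate_pred (hn : t + 2 ≤ n) (v : Fin n → Value) (hb : b < m)
    (hcrash : #(crashing m s) ≤ t) (hdead : #(crashing (b + 1) s) + m ≤ t + b + 2)
    (hlost : b + 1 < m → ∀ l, b + 1 ≤ (s l).1 → lost (pattern m s) (b + 1) l + m ≤ t + b + 1) :
    Reachable t m (pattern m (truncate m (b + 1) s), v) (pattern m (truncate m b s), v) := by
  have settled := truncate_settled m (b + 1) s
  have hcard := congrArg Finset.card (crashing_truncate (s := s) (show b + 1 ≤ m from hb))
  rw [← truncate_truncate_succ hb]
  by_cases hroom : #(crashing (b + 1) s) + m ≤ t + b + 1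
  · exact reachable_truncate_of_hasRoom hn v hb ⟨settled, by omega⟩
  have hb' : b + 1 < m := by
    refine lt_of_le_of_ne hb fun h => ?_
    rw [h] at hroom
    omega
  have few_lost : ∀ l, m ≤ (truncate m (b + 1) s l).1 →
      lost (pattern m (truncate m (b + 1) s)) (b + 1) l
        < #(crashing m (truncate m (b + 1) s)) := by
    intro l hl
    have hl' : b + 1 ≤ (s l).1 := by
      by_contra! h
      rw [truncate_of_lt h] at hl
      omega
    have := hlost hb' l hl'
    have unchanged : lost (pattern m (truncate m (b + 1) s)) (b + 1) l =
        lost (pattern m s) (b + 1) l := by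
      simp only [lost, pattern_truncate_of_lt b.lt_succ_self]
    omega
  obtain ⟨i, hi, uncrashed⟩ := exists_reachable_uncrash hn v hb' ⟨settled, by omega⟩ few_lost
  refine uncrashed.trans ?_
  rw [← truncate_uncrash hb.le hi.ge]
  refine reachable_truncate_of_hasRoom hn v hb ⟨fun x => ?_, ?_⟩
  · rcases eq_or_ne x i with rfl | hxi
    · simp
    · simpa [hxi] using settled x
  · have him := mem_crashing.mpr (hi.trans_lt hb)
    have := Finset.card_erase_add_one him
    rw [crashing_update_of_le le_rfl]
    omega

theorem reachable_top_of_schedule (hn : t + 2 ≤ n) (v : Fin n → Value)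
    (hdead : ∀ b ≤ m, #(crashing b s) + m ≤ t + b + 1) (hcrash : #(crashing m s) ≤ t)
    (hlost : ∀ b < m, ∀ l, b ≤ (s l).1 → lost (pattern m s) b l + m ≤ t + b) :
    Reachable t m (pattern m s, v) (⊤, v) := by
  have key : ∀ b ≤ m, Reachable t m (pattern m s, v) (pattern m (truncate m b s), v) := by
    intro b hb
    induction hb using Nat.decreasingInduction with
    | self =>
      rw [pattern_truncate_of_settled fun i => lt_or_ge _ _]
      exact Reachable.refl _
    | of_succ b hb ih =>
      exact ih.trans (reachable_truncate_pred hn v hb hcrash (hdead (b + 1) hb) (hlost (b + 1)))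
  have htop : pattern m (truncate m 0 s) = ⊤ := by
    funext k i j
    exact pattern_eq_true_of_le (by rw [truncate_of_le (Nat.zero_le _)])
  exact htop ▸ key 0 m.zero_le

/-- To change the initial value of an agent, first make it silent from the start. -/
theorem reachable_top_of_values (hn : t + 2 ≤ n) (hm : m ≤ t) (v w : Fin n → Value) :
    Reachable t m ((⊤ : FailurePattern n), v) (⊤, w) := by
  let s : Schedule n := fun _ => (m, ∅)
  have htop : pattern m s = ⊤ := by
    funext k i j
    exact pattern_eq_true_of_le le_rfl
  have hs : HasRoom t m 0 s := ⟨fun _ => Or.inr le_rfl, by simpa [crashing, s] using hm⟩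
  have change : ∀ (v w : Fin n → Value) (j : Fin n), (∀ i ≠ j, v i = w i) →
      Reachable t m (pattern m s, v) (pattern m s, w) := by
    intro v w j hvw
    have silenced := hs.pattern_crash_now_mem m.zero_le j ∅
    have silence := fun v => canSilence hn v m.zero_le hs (j := j) le_rfl
    refine (silence v).trans (Reachable.trans ?_ (silence w).symm)
    refine reachable_of_silent (b := 0) (j := j) hn silenced silenced
      (fun i hi => hvw i fun h => (hi h).false) (fun k hk _ x => ?_) fun _ _ _ _ _ => rfl
    simp only [pattern_eq_false_iff, Function.update_self, Finset.notMem_empty]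
    exact ⟨by omega, k.zero_le, fun _ h => h.elim⟩
  have piecewise : ∀ R : Finset (Fin n),
      Reachable t m (pattern m s, v) (pattern m s, R.piecewise w v) := by
    intro R
    induction R using Finset.induction_on with
    | empty =>
      rw [Finset.piecewise_empty]
      exact Reachable.refl _
    | insert j R _ ih =>
      refine ih.trans (change _ _ j fun i hi => ?_)
      exact (Finset.piecewise_insert_of_ne R w v hi).symm
  simpa only [htop, Finset.piecewise_univ] using piecewise Finset.univ

/-! ### Low estimates -/

/-- The time at which the round of the crash of `i` starts, cut off at `m`. -/
def crashTime (m : ℕ) (F : FailurePattern n) (i : Fin n) : ℕ :=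
  Nat.find (⟨m, Or.inl le_rfl⟩ : ∃ k, m ≤ k ∨ F k i i = false)

/-- The crash schedule of the failure pattern `F` up to time `m`. -/
def schedule (m : ℕ) (F : FailurePattern n) : Schedule n :=
  fun i => (crashTime m F i, ({j | F (crashTime m F i) i j = true} : Finset (Fin n)))

theorem alive_iff_le_crashTime (hb : b ≤ m) : Alive F b i ↔ b ≤ crashTime m F i := by
  rw [crashTime, Nat.le_find_iff]
  refine forall₂_congr fun k hk => ?_
  simp [hk.trans_le hb]

theorem crashing_schedule (hb : b ≤ m) : crashing b (schedule m F) = dead F b := by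
  ext i
  rw [mem_crashing, mem_dead, alive_iff_le_crashTime hb, not_le]
  rfl

theorem pattern_schedule (hF : F ∈ Crash n t) (hk : k < m) :
    pattern m (schedule m F) k = F k := by
  funext i j
  have alive_iff := alive_iff_le_crashTime (F := F) (i := i) hk.le
  have alive_succ_iff := alive_iff_le_crashTime (F := F) (i := i) (Nat.succ_le_of_lt hk)
  rw [Bool.eq_iff_iff, pattern_eq_true_iff]
  simp only [schedule, Finset.mem_filter, Finset.mem_univ, true_and]
  rcases lt_trichotomy k (crashTime m F i) with h | h | h
  · exact iff_of_true (Or.inr (Or.inl h)) ((alive_succ_iff.mpr h).delivered hF)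
  · have crashes : ¬ F k i i = true := fun hc =>
      h.not_lt (alive_succ_iff.mp (alive_succ.mpr ⟨alive_iff.mpr h.le, hc⟩))
    have hij : F k i j = true → j ≠ i := by
      rintro hj rfl
      exact crashes hj
    simp only [← h, hk.not_ge, lt_irrefl, true_and, false_or, and_iff_left_iff_imp]
    exact hij
  · have not_alive : ¬ Alive F k i := fun hi => h.not_ge (alive_iff.mp hi)
    rw [not_delivered_of_not_alive hF not_alive]
    simp only [Bool.false_eq_true, iff_false]
    omega

theorem reachable_top (hn : t + 2 ≤ n) (hF : F ∈ Crash n t) (v : Fin n → Value)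
    (hdead : ∀ b ≤ m, #(dead F b) + m ≤ t + b + 1)
    (hlost : ∀ b < m, ∀ l, Alive F b l → lost F b l + m ≤ t + b) :
    Reachable t m (F, v) (⊤, v) := by
  obtain ⟨i, -, hi⟩ := exists_alive_ne hn hF m ⟨0, by omega⟩
  have agree : ∀ b ≤ m, ∀ k < b, F k = pattern m (schedule m F) k := fun b hb k hk =>
    (pattern_schedule hF (hk.trans_le hb)).symm
  have hcrash : #(crashing m (schedule m F)) ≤ t := by
    rw [crashing_schedule le_rfl]
    exact card_dead_le hF m
  have toSchedule : Reachable t m (F, v) (pattern m (schedule m F), v) :=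
    reachable_of_sameView hF (pattern_mem_crash hcrash) hi
      (alive_pattern_iff.mpr ((alive_iff_le_crashTime le_rfl).mp hi))
      (sameView_of_eqOn v (agree m le_rfl) i)
  refine toSchedule.trans (reachable_top_of_schedule hn v (fun b hb => ?_) hcrash
    fun b hb l hl => ?_)
  · rw [crashing_schedule hb]
    exact hdead b hb
  · rw [← (sameView_of_eqOn v (agree b hb.le) l).lost]
    exact hlost b hb l ((alive_iff_le_crashTime hb.le).mpr hl)

theorem card_dead_le_lost_succ (hF : F ∈ Crash n t) : #(dead F m) ≤ lost F (m + 1) i :=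
  card_le_lost_succ fun _ hj => not_delivered_of_not_alive hF (mem_dead.mp hj)

theorem lost_le_est_add (F : FailurePattern n) (hb : b ≤ m) (i : Fin n) :
    (lost F b i : ℤ) ≤ est F m i + b := by
  have hlost := lost_sub_le_est F b i
  have hmono : est F b i ≤ est F m i := est_mono F i hb
  omega

theorem card_dead_le_est_add (hF : F ∈ Crash n t) (hb : b < m) (i : Fin n) :
    (#(dead F b) : ℤ) ≤ est F m i + b + 1 := by
  have hdead := card_dead_le_lost_succ (m := b) (i := i) hF
  have hlost := lost_le_est_add F (b := b + 1) hb i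
  push_cast at hlost
  omega

/-- If the message of `j` in round `b + 1` does not reach `i`, then `i` misses one message more
than `j` did. -/
theorem lost_le_est_add_of_alive (hF : F ∈ Crash n t) (hb : b < m) (hj : Alive F b j)
    (i : Fin n) : (lost F b j : ℤ) ≤ est F m i + b := by
  by_cases hji : F b j i = true
  · have hlost := lost_sub_le_est F b j
    have hrecv := est_le_of_delivered hji
    have hmono : est F (b + 1) i ≤ est F m i := est_mono F i hb
    omega
  · have hlost := lost_le_card_dead hF b j
    have hinsert : #(insert j (dead F b)) ≤ lost F (b + 1) i := card_le_lost_succ fun x hx => by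
      rcases Finset.mem_insert.mp hx with rfl | hx
      · exact Bool.eq_false_iff.mpr hji
      · exact not_delivered_of_not_alive hF (mem_dead.mp hx)
    rw [Finset.card_insert_of_notMem fun h => mem_dead.mp h hj] at hinsert
    have hlost' := lost_le_est_add F (b := b + 1) hb i
    push_cast at hlost'
    omega

/-- The failure pattern `F`, except that from round `m + 1` on all agents receive messages from the
same agents as `i` does in round `m + 1`. Agent `i` cannot see the difference, and all crashes are
now covered by its missing messages. -/
def collapse (F : FailurePattern n) (m : ℕ) (i : Fin n) : FailurePattern n :=
  fun k x y => if k < m then F k x y else F m x i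

theorem collapse_of_lt (hk : k < m) : collapse F m i k = F k := by
  funext x y
  exact if_pos hk

theorem collapse_of_le (hk : m ≤ k) (x y : Fin n) : collapse F m i k x y = F m x i :=
  if_neg hk.not_gt

theorem not_delivered_of_collapse (hF : F ∈ Crash n t) {x y : Fin n}
    (h : collapse F m i k x y = false) : F m x i = false := by
  rcases lt_or_ge k m with hk | hk
  · rw [collapse_of_lt hk] at h
    exact hF.2.1 k x (hF.1 k x y h) m hk i
  · rwa [collapse_of_le hk] at h

theorem collapse_mem_crash (hF : F ∈ Crash n t) :
    collapse F m i ∈ Crash n (lost F (m + 1) i) := by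
  refine ⟨fun k x y h => ?_, fun k x h k' hk y => ?_, ?_⟩
  · rcases lt_or_ge k m with hk | hk
    · rw [collapse_of_lt hk] at h ⊢
      exact hF.1 k x y h
    · rwa [collapse_of_le hk] at h ⊢
  · rcases lt_or_ge k' m with hk' | hk'
    · rw [collapse_of_lt (hk.trans hk')] at h
      rw [collapse_of_lt hk']
      exact hF.2.1 k x h k' hk y
    · rw [collapse_of_le hk']
      exact not_delivered_of_collapse hF h
  · rw [lost, ← Set.ncard_coe_finset]
    refine Set.ncard_le_ncard ?_ (Set.toFinite _)
    rintro x ⟨k, y, h⟩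
    simpa using not_delivered_of_collapse hF h

theorem sameView_collapse (F : FailurePattern n) (v : Fin n → Value) (m : ℕ) (i : Fin n) :
    SameView F (collapse F m i) v v (m + 1) i := by
  have before := sameView_of_eqOn (F := F) (F' := collapse F m i) v fun _ hk =>
    (collapse_of_lt hk).symm
  exact (before i).succ (fun j => (collapse_of_le le_rfl j i).symm) fun j _ => before j

theorem alive_collapse (hi : Alive F (m + 1) i) : Alive (collapse F m i) (m + 1) i := by
  refine alive_succ.mpr ⟨fun k hk => ?_, ?_⟩
  · rw [collapse_of_lt hk]
    exact hi k (hk.trans m.lt_succ_self)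
  · rw [collapse_of_le le_rfl]
    exact (alive_succ.mp hi).2

theorem reachable_top_of_est_le {c : ℕ} (hn : c + 2 ≤ n) (hct : c ≤ t) (hF : F ∈ Crash n t)
    (hi : Alive F m i) (hc : est F m i + m ≤ c) (v : Fin n → Value) :
    Reachable t m (F, v) (⊤, v) := by
  cases m with
  | zero => exact reachable_of_sameView hF top_mem_crash hi alive_zero (sameView_zero rfl)
  | succ m =>
    have view := sameView_collapse F v m i
    have hlost := lost_le_est_add F (le_refl (m + 1)) i
    have hF' : collapse F m i ∈ Crash n c := crash_subset_crash (by omega) (collapse_mem_crash hF)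
    refine (reachable_of_sameView hF (crash_subset_crash hct hF') hi (alive_collapse hi) view).trans
      (Reachable.mono hct (reachable_top hn hF' v (fun b hb => ?_) fun b hb l hl => ?_))
    · rcases hb.lt_or_eq with hb | rfl
      · have := card_dead_le_est_add hF' hb i
        rw [← view.est] at this
        omega
      · have := card_dead_le hF' (m + 1)
        omega
    · have := lost_le_est_add_of_alive hF' hb hl i
      rw [← view.est] at this
      omega

theorem reachable_of_not_ready (hF : F ∈ Crash n t) (hi : Alive F m i) (h : ¬ Ready t F m i)
    (v w : Fin n → Value) : Reachable t m (F, v) (⊤, w) := by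
  have hest := est_nonneg F m i
  rw [Ready, not_le] at h
  obtain ⟨c, hc⟩ : ∃ c : ℕ, est F m i + m = c := Int.eq_ofNat_of_zero_le (by omega)
  have hn : c + 2 ≤ n := by omega
  have hct : c ≤ t := by omega
  exact (reachable_top_of_est_le hn hct hF hi hc.le v).trans
    (Reachable.mono hct (reachable_top_of_values hn (by omega) v w))

/-! ### The protocol `P^send` -/

theorem pSend_state_eq_decide_iff (hi : Alive F m i) {y : Value} :
    pSend n t i (state F v m i) = Action.decide y ↔
      Ready t F m i ∧ ∃ hW : (vals F v m i).Nonempty, (vals F v m i).min' hW = y := by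
  rw [state_of_alive hi]
  simp only [pSend, Ready]
  split_ifs with hready hW
  · simp [hready, hW]
  · simp [hW]
  · simp [hready]

theorem Ready.exists_decide (h : Ready t F m i) (hi : Alive F m i) (v : Fin n → Value) :
    ∃ y, pSend n t i (state F v m i) = Action.decide y :=
  ⟨_, (pSend_state_eq_decide_iff hi).mpr ⟨h, ⟨_, mem_vals_self hi⟩, rfl⟩⟩

theorem mem_vals_of_decide (hi : Alive F m i) {y : Value}
    (h : pSend n t i (state F v m i) = Action.decide y) : y ∈ vals F v m i := by
  obtain ⟨-, hW, rfl⟩ := (pSend_state_eq_decide_iff hi).mp h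
  exact Finset.min'_mem _ hW

theorem pSend_agreement (hF : F ∈ Crash n t) {m' : ℕ} (hmm' : m ≤ m') (hi : Alive F m i)
    (hj : Alive F m' j) {x y : Value} (hx : pSend n t i (state F v m i) = Action.decide x)
    (hy : pSend n t j (state F v m' j) = Action.decide y) : x = y := by
  obtain ⟨hready, hW, rfl⟩ := (pSend_state_eq_decide_iff hi).mp hx
  obtain ⟨-, hW', rfl⟩ := (pSend_state_eq_decide_iff hj).mp hy
  have common : vals F v m' j = vals F v m i :=
    vals_eq_of_common hF hmm' (fun x hx => (hready.vals_eq hF hi hx).symm) hj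
  simp only [common]

theorem pSend_simultaneity (hF : F ∈ Crash n t) (hi : Alive F m i) (hj : Alive F m j) {x : Value}
    (hx : pSend n t i (state F v m i) = Action.decide x) :
    pSend n t j (state F v m j) = Action.decide x := by
  have hready := ((pSend_state_eq_decide_iff hi).mp hx).1
  obtain ⟨y, hy⟩ := (hready.of_alive hF hi hj).exists_decide hj v
  rwa [pSend_agreement hF le_rfl hi hj hx hy]

section Runs

variable {P : DecisionProtocol (sendWaste n)} {r : Run (sendWaste n)}

theorem Ready.exists_commonKnowledge (h : Ready t (r 0).env m i)
    (hr : r ∈ system (sendWaste n) t P) (hi : Alive (r 0).env m i) :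
    ∃ x, CommonKnowledge (system (sendWaste n) t P) (existsInit (sendWaste n) x) r m := by
  obtain ⟨x, hx⟩ := h.exists_decide hi (inits r)
  refine ⟨x, commonKnowledge_of_invariant (fun r m => ∃ i, Alive (r 0).env m i ∧
    pSend n t i (state (r 0).env (inits r) m i) = Action.decide x) ?_ ?_ hr ⟨i, hi, hx⟩⟩
  · rintro r - m ⟨i, hi, hx⟩
    exact exists_init_of_mem_vals (mem_vals_of_decide hi hx)
  · rintro r hr m ⟨i, hi, hx⟩ j hj r' hr' m' hl
    refine ⟨j, (mem_nonfailed_iff hr').mp ((mem_nonfailed_congr hl).mp hj), ?_⟩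
    rw [← loc_eq_state hr' m' j, ← hl, loc_eq_state hr m j]
    exact pSend_simultaneity hr.env_mem hi ((mem_nonfailed_iff hr).mp hj) hx

theorem ready_of_commonKnowledge (hr : r ∈ system (sendWaste n) t P) (hi : Alive (r 0).env m i)
    {x : Value}
    (h : CommonKnowledge (system (sendWaste n) t P) (existsInit (sendWaste n) x) r m) :
    Ready t (r 0).env m i := by
  by_contra hready
  have reach := reachable_of_not_ready hr.env_mem hi hready (inits r) fun _ => x + 1
  have hrun := runOf_mem_system (a := ((r 0).env, inits r)) hr.env_mem P
  have htop := runOf_mem_system (a := ((⊤ : FailurePattern n), fun _ => x + 1)) (t := t)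
    top_mem_crash P
  have h' := reach.commonKnowledge_iff.mp
    (h.of_loc_eq ((mem_nonfailed_iff hr).mpr hi) hrun (loc_eq_state hr m i))
  obtain ⟨j, hj⟩ := h'.holds htop ((mem_nonfailed_iff (i := i) htop).mpr alive_top)
  have hx : x + 1 = x := (congrFun (inits_runOf _) j).symm.trans hj
  simp at hx

theorem commonKnowledge_iff (hr : r ∈ system (sendWaste n) t P)
    (hne : (nonfailed (sendWaste n) r m).Nonempty) :
    (∃ x, CommonKnowledge (system (sendWaste n) t P) (existsInit (sendWaste n) x) r m) ↔
      (m : ℤ) ≥ min ((t : ℤ) + 1) ((n : ℤ) - 1) - maxWaste r m hne := by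
  obtain ⟨j, hj, hmax⟩ := Finset.exists_mem_eq_sup' hne fun i => wasteEstimate ((r m).loc i)
  have hj' := (mem_nonfailed_iff hr).mp hj
  rw [maxWaste, hmax, wasteEstimate_loc hr hj']
  exact ⟨fun ⟨x, hx⟩ => ready_of_commonKnowledge hr hj' hx,
    fun h => Ready.exists_commonKnowledge h hr hj'⟩

end Runs

theorem pSend_isSBA : IsSBA (sendWaste n) t (pSend n t) where
  agreement r hr m m' i hi j hj v v' hv hv' := by
    rw [mem_nonfailed_iff hr] at hi hj
    rw [loc_eq_state hr] at hv hv'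
    rcases le_total m m' with h | h
    · exact pSend_agreement hr.env_mem h hi hj hv hv'
    · exact (pSend_agreement hr.env_mem h hj hi hv' hv).symm
  validity r hr m i hi v hv := by
    rw [mem_nonfailed_iff hr] at hi
    rw [loc_eq_state hr] at hv
    exact exists_init_of_mem_vals (mem_vals_of_decide hi hv)
  simultaneity r hr m i hi j hj := by
    rw [mem_nonfailed_iff hr] at hi hj
    rw [loc_eq_state hr, loc_eq_state hr]
    exact Exists.imp fun _ => pSend_simultaneity hr.env_mem hi hj

theorem pSend_isOptimumSBA : IsOptimumSBA (sendWaste n) t (pSend n t) := by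
  refine ⟨pSend_isSBA, ?_⟩
  rintro P hP r hr r' hr' ⟨henv, -⟩ m i hi ⟨x, hx⟩
  have hi' := (mem_nonfailed_iff hr).mp hi
  have hready := ready_of_commonKnowledge hr hi' (hP.commonKnowledge hr hi hx)
  rw [loc_eq_state hr' m i]
  rw [henv] at hi' hready
  exact hready.exists_decide hi' (inits r')

theorem pSend_terminates : Terminates (sendWaste n) t (pSend n t) := by
  intro r hr i
  refine ⟨n, or_iff_not_imp_left.mpr fun hi => ?_⟩
  have hi' := (mem_nonfailed_iff hr).mp (not_not.mp hi)
  have hready : Ready t (r 0).env n i := by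
    have := est_nonneg (r 0).env n i
    unfold Ready
    omega
  rw [loc_eq_state hr]
  exact hready.exists_decide hi' (inits r)

end SendWaste

end SBA

theorem mainTheorem8 (n t : ℕ) (ht : t < n) :
    (∀ P : SBA.DecisionProtocol (SBA.sendWaste n),
      ∀ r ∈ SBA.system (SBA.sendWaste n) t P, ∀ (m : ℕ) (i : Fin n)
        (hi : i ∈ SBA.nonfailed (SBA.sendWaste n) r m),
        (∃ v : SBA.Value,
          SBA.CommonKnowledge (SBA.system (SBA.sendWaste n) t P)
            (SBA.existsInit (SBA.sendWaste n) v) r m) ↔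
        (m : ℤ) ≥ min ((t : ℤ) + 1) ((n : ℤ) - 1) - SBA.maxWaste r m ⟨i, hi⟩) ∧
    SBA.IsOptimumSBA (SBA.sendWaste n) t (SBA.pSend n t) ∧
    SBA.Terminates (SBA.sendWaste n) t (SBA.pSend n t) :=
  ⟨fun _ _ hr _ i hi => SBA.SendWaste.commonKnowledge_iff hr ⟨i, hi⟩,
    SBA.SendWaste.pSend_isOptimumSBA, SBA.SendWaste.pSend_terminates⟩
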